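/- Let $\rho>0$ and $\sigma>0$. Consider an $M/M/\infty$ queue with arrival rate $\rho$ and unit service rate that is empty at time $0$: customers arrive at the points of a Poisson process of intensity $\rho$ on $(0,\infty)$ and each is served immediately, the service times being independent and exponential with mean $1$. An observer, independent of the queue, leaves after an exponential time with mean $1/\sigma$. Let $\nu(\sigma)$ be the number of customers in the queue when the observer leaves. Define polynomials $P_n(\sigma;x)$, $n\ge 0$, by $P_{-1}=0$, $P_0=1$ and $$\rho P_{n+1}(\sigma;x)-(n+\sigma+\rho)\,x\,P_n(\sigma;x)+nP_{n-1}(\sigma;x)=0,$$ and the measure (with $\delta_a$ the Dirac mass at $a$) $$d\psi(\sigma;x)=\sum_{k=0}^\infty r_k(\sigma)\bigl(\delta_{s_k^+(\sigma)}(dx)+\delta_{s_k^-(\sigma)}(dx)\bigr),$$ where $$s_k^\pm(\sigma)=\pm\sqrt{\frac{\rho}{\sigma+\rho+k}},\qquad r_k(\sigma)=\frac{\sigma+\rho}{2(\sigma+\rho+k)}\,\frac{(\sigma+\rho+k)^k}{k!}\,e^{-(\sigma+\rho+k)}.$$ Let $C_n(x;\rho)$, $n\ge0$, be the Charlier polynomials,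 given by $C_{-1}=0$, $C_0=1$ and $\rho\, C_{n+1}(x;\rho)+(x-n-\rho)C_n(x;\rho)+nC_{n-1}(x;\rho)=0$, and let $\mathcal P_\rho$ be the Poisson measure on $\mathbb R$ with mean $\rho$, that is, with mass $e^{-\rho}\rho^n/n!$ at each $n=0,1,2,\dots$. Then, for every integer $m\ge 0$, $$\mathbb P(\nu(\sigma)=m)=\frac{\sigma}{\sigma+\rho}\,\frac{\rho^m}{m!}\int_{-\infty}^{\infty}\frac{P_m(\sigma;x)}{1-x}\,d\psi(\sigma;x)=\sigma\,\frac{\rho^m}{m!}\int_{[0,\infty)}\frac{C_m(x;\rho)}{\sigma+x}\,d\mathcal P_\rho(x),$$ both integrals being absolutely convergent. -/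

import Mathlib

open MeasureTheory ProbabilityTheory
open scoped ENNReal Nat

/-- Primitive data of an `M/M/∞` queue with arrival rate `ρ` and unit service rate that is empty at
time `0`, together with an observer who stays for an exponential time with mean `1 / σ`:
`τ i` is the time between the arrivals of customers `i - 1` and `i` (for `i = 0`, the time of the
first arrival), `S i` is the service time of customer `i`, and `T` is the time at which the
observer leaves. All these variables are mutually independent. -/
structure IsObservedMMInfQueue {Ω : Type*} [MeasurableSpace Ω] (μ : Measure Ω) (ρ σ : ℝ)
    (τ S : ℕ → Ω → ℝ) (T : Ω → ℝ) : Prop where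
  interarrival_law : ∀ i, HasLaw (τ i) (expMeasure ρ) μ
  service_law : ∀ i, HasLaw (S i) (expMeasure 1) μ
  observer_law : HasLaw T (expMeasure σ) μ
  indep : iIndepFun (Sum.elim τ (Sum.elim S (fun _ : Unit => T))) μ

/-- Arrival time of customer `i`. -/
def arrivalTime {Ω : Type*} (τ : ℕ → Ω → ℝ) (i : ℕ) (ω : Ω) : ℝ :=
  ∑ j ∈ Finset.range (i + 1), τ j ω

/-- `N(t)`: the number of customers who have arrived by time `t` and have not yet departed; every
customer is served at once, so customer `i` departs at time `arrivalTime τ i + S i`. -/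
noncomputable def numCustomers {Ω : Type*} (τ S : ℕ → Ω → ℝ) (t : ℝ) (ω : Ω) : ℕ∞ :=
  {i : ℕ | arrivalTime τ i ω ≤ t ∧ t < arrivalTime τ i ω + S i ω}.encard

/-- `ν(σ)`: the number of customers present when the observer leaves. -/
noncomputable def numAtObserverExit {Ω : Type*} (τ S : ℕ → Ω → ℝ) (T : Ω → ℝ) (ω : Ω) : ℕ∞ :=
  numCustomers τ S (T ω) ω

/-- The Charlier polynomials `C_n(x; a)`. -/
noncomputable def charlier (a : ℝ) : ℕ → ℝ → ℝ
  | 0, _ => 1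
  | 1, x => (a - x) / a
  | n + 2, x => (((n + 1 : ℕ) + a - x) * charlier a (n + 1) x - (n + 1 : ℕ) * charlier a n x) / a

/-- The recurrence that defines the Charlier polynomials, with `C_{-1} = 0`. -/
theorem charlier_rec (a : ℝ) (ha : 0 < a) (n : ℕ) (x : ℝ) :
    a * charlier a (n + 1) x + (x - n - a) * charlier a n x
      + n * (if n = 0 then 0 else charlier a (n - 1) x) = 0 := by
  rcases n with _ | n <;> simp [charlier] <;> field_simp <;> ring

/-- The polynomials `P_n(σ; x)` attached to the transition matrix of the queue observed until the
observer leaves. -/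
noncomputable def queuePoly (ρ σ : ℝ) : ℕ → ℝ → ℝ
  | 0, _ => 1
  | 1, x => (σ + ρ) * x / ρ
  | n + 2, x => (((n + 1 : ℕ) + σ + ρ) * x * queuePoly ρ σ (n + 1) x
      - (n + 1 : ℕ) * queuePoly ρ σ n x) / ρ

/-- The recurrence that defines the polynomials `P_n(σ; x)`, with `P_{-1} = 0`. -/
theorem queuePoly_rec (ρ σ : ℝ) (hρ : 0 < ρ) (n : ℕ) (x : ℝ) :
    ρ * queuePoly ρ σ (n + 1) x - (n + σ + ρ) * x * queuePoly ρ σ n x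
      + n * (if n = 0 then 0 else queuePoly ρ σ (n - 1) x) = 0 := by
  rcases n with _ | n <;> simp [queuePoly] <;> field_simp <;> ring

/-- The positive atom `s_k⁺(σ)`; the negative atom `s_k⁻(σ)` is its opposite. -/
noncomputable def spectralAtom (ρ σ : ℝ) (k : ℕ) : ℝ :=
  Real.sqrt (ρ / (σ + ρ + k))

/-- The mass `r_k(σ)` at each of the two atoms `s_k^±(σ)`. -/
noncomputable def spectralMass (ρ σ : ℝ) (k : ℕ) : ℝ :=
  (σ + ρ) / (2 * (σ + ρ + k)) * ((σ + ρ + k) ^ k / (k ! : ℝ)) * Real.exp (-(σ + ρ + k))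

/-- The spectral measure `dψ(σ; x)`. -/
noncomputable def spectralMeasure (ρ σ : ℝ) : Measure ℝ :=
  Measure.sum fun k : ℕ => ENNReal.ofReal (spectralMass ρ σ k) •
    (Measure.dirac (spectralAtom ρ σ k) + Measure.dirac (-spectralAtom ρ σ k))

/-- The Poisson measure on `ℝ` with mean `a` (for `a ≥ 0`). -/
noncomputable def poissonOnReal (a : ℝ) : Measure ℝ :=
  (poissonMeasure a.toNNReal).map (Nat.cast : ℕ → ℝ)

/-! All three quantities are explicit multiples of one integral, I_m(σ, ρ) = ∫_0^∞ e^{-σt}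
e^{-ρ(1-e^{-t})} (1-e^{-t})^m dt, written `exitIntegral m σ ρ`.

Queue. At time t the number of customers is Poisson with mean ρ(1-e^{-t}). Splitting off the first
customer gives a renewal equation for the probabilities; the Poisson weights solve it too
(`queueWeight_renewal`), and a contraction argument shows that bounded solutions are unique
(`eq_of_renewal`). Averaging over the exponential exit time gives σ ρ^m/m! I_m(σ, ρ).

Charlier side. For m = 0, expand e^{ρ e^{-t}} and integrate termwise. The step in m matches
I_{m+1}(σ) = I_m(σ) - I_m(σ+1) with the relation a C_{m+1}(x) = a C_m(x) - x C_m(x-1)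
(`hasSum_charlier_div`).

Spectral side. Lagrange's expansion of e^{az}/(1-z) in powers of z e^{-z}, taken at z = e^{-t} and
integrated, sums the series over the atoms (`hasSum_exitIntegral_zero`). The value at x = 1 alone
does not determine the next term of the recurrence, since ∫ P_n dψ enters it. So a parameter s is
inserted: ∫ P_n/(1-sx) dψ = (σ+ρ) s^n I_n(σ+ρ-s²ρ, s²ρ) for 0 < s ≤ 1 (`spectralTransform_eq`). The
right side is O(s^n), so s → 0 gives ∫ P_n dψ = 0 for n ≥ 1, and the induction closes because I_n
obeys the same three-term recurrence (`exitIntegral_rec`). Then take s = 1. -/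

/-! ### Exit integrals and their recurrences -/

/-- The integral over `(0, ∞)` of `e^{-σ t} e^{-ρ (1 - e^{-t})} (1 - e^{-t})^m`. -/
noncomputable def exitIntegral (m : ℕ) (σ ρ : ℝ) : ℝ :=
  ∫ t in Set.Ioi (0 : ℝ),
    Real.exp (-σ * t) * Real.exp (-ρ * (1 - Real.exp (-t))) * (1 - Real.exp (-t)) ^ m

theorem one_sub_exp_neg_mem_Icc {t : ℝ} (ht : 0 ≤ t) :
    1 - Real.exp (-t) ∈ Set.Icc (0 : ℝ) 1 := by
  have h1 : Real.exp (-t) ≤ 1 := Real.exp_le_one_iff.2 (by linarith)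
  have h2 := Real.exp_pos (-t)
  constructor <;> linarith

theorem exitIntegrand_le (m : ℕ) {σ ρ t : ℝ} (ht : 0 ≤ t) :
    ‖Real.exp (-σ * t) * Real.exp (-ρ * (1 - Real.exp (-t))) * (1 - Real.exp (-t)) ^ m‖
      ≤ Real.exp |ρ| * Real.exp (-σ * t) := by
  obtain ⟨h0, h1⟩ := one_sub_exp_neg_mem_Icc ht
  have h2 : (1 - Real.exp (-t)) ^ m ≤ 1 := pow_le_one₀ h0 h1
  have h3 : Real.exp (-ρ * (1 - Real.exp (-t))) ≤ Real.exp |ρ| := by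
    apply Real.exp_le_exp.2
    nlinarith [neg_abs_le ρ, le_abs_self ρ, abs_nonneg ρ]
  rw [Real.norm_of_nonneg (by positivity)]
  calc _ ≤ Real.exp (-σ * t) * Real.exp |ρ| * 1 := by gcongr
    _ = _ := by ring

theorem integrableOn_exitIntegrand (m : ℕ) {σ : ℝ} (ρ : ℝ) (hσ : 0 < σ) :
    IntegrableOn (fun t => Real.exp (-σ * t) * Real.exp (-ρ * (1 - Real.exp (-t))) *
      (1 - Real.exp (-t)) ^ m) (Set.Ioi 0) := by
  refine Integrable.mono' ((exp_neg_integrableOn_Ioi 0 hσ).const_mul (Real.exp |ρ|)) ?_ ?_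
  · exact Continuous.aestronglyMeasurable (by fun_prop)
  · filter_upwards [ae_restrict_mem measurableSet_Ioi] with t ht
    exact exitIntegrand_le m (le_of_lt ht)

/-- The extra factor 1 - e^{-t} splits the integrand, and e^{-t} is absorbed as σ ↦ σ + 1. -/
theorem exitIntegral_succ (m : ℕ) {σ : ℝ} (ρ : ℝ) (hσ : 0 < σ) :
    exitIntegral (m + 1) σ ρ = exitIntegral m σ ρ - exitIntegral m (σ + 1) ρ := by
  unfold exitIntegral
  rw [← integral_sub (integrableOn_exitIntegrand m ρ hσ)
    (integrableOn_exitIntegrand m ρ (by linarith))]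
  congr 1
  ext t
  have : Real.exp (-(σ + 1) * t) = Real.exp (-σ * t) * Real.exp (-t) := by
    rw [← Real.exp_add]; ring_nf
  rw [this]; ring

/-- The bound does not depend on m; it controls the spectral transforms as s → 0. -/
theorem norm_exitIntegral_le (m : ℕ) {σ : ℝ} (ρ : ℝ) (hσ : 0 < σ) :
    ‖exitIntegral m σ ρ‖ ≤ Real.exp |ρ| / σ := by
  have h := norm_integral_le_of_norm_le (μ := volume.restrict (Set.Ioi (0:ℝ)))
    ((exp_neg_integrableOn_Ioi 0 hσ).const_mul (Real.exp |ρ|))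
    (ae_restrict_of_forall_mem measurableSet_Ioi
      fun t ht => exitIntegrand_le m (σ := σ) (ρ := ρ) (le_of_lt ht))
  refine h.trans (le_of_eq ?_)
  rw [integral_const_mul, integral_exp_mul_Ioi (by linarith)]
  simp
  field_simp

theorem exitIntegral_zero_zero {σ : ℝ} (hσ : 0 < σ) : exitIntegral 0 σ 0 = 1 / σ := by
  unfold exitIntegral
  simp only [neg_zero, zero_mul, Real.exp_zero, mul_one, pow_zero]
  rw [integral_exp_mul_Ioi (by linarith)]
  simp

/-- The three-term recurrence of the exit integrals in `m`. -/
theorem exitIntegral_rec (m : ℕ) {σ : ℝ} (ρ : ℝ) (hσ : 0 < σ) :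
    ρ * exitIntegral (m + 1) σ ρ = (m + (σ + ρ)) * exitIntegral m σ ρ
      - m * exitIntegral (m - 1) σ ρ - if m = 0 then 1 else 0 := by
  -- The recurrence is ∫ F' = -F(0) for F the integrand itself. With y = 1 - e^{-t}, replacing
  -- e^{-t} by 1 - y makes F' a combination of the integrands for m + 1, m and m - 1. At m = 0 the
  -- truncated m - 1 is harmless, its coefficient being 0.
  set F : ℝ → ℝ := fun t => Real.exp (-σ * t) * Real.exp (-ρ * (1 - Real.exp (-t))) *
      (1 - Real.exp (-t)) ^ m with hF
  set g : ℕ → ℝ → ℝ := fun m t => Real.exp (-σ * t) * Real.exp (-ρ * (1 - Real.exp (-t))) *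
      (1 - Real.exp (-t)) ^ m with hg
  have hgi : ∀ m, IntegrableOn (g m) (Set.Ioi 0) := fun m => integrableOn_exitIntegrand m ρ hσ
  have hd : ∀ t, HasDerivAt F
      (ρ * g (m + 1) t - (m + (σ + ρ)) * g m t + m * g (m - 1) t) t := by
    intro t
    have e1 : HasDerivAt (fun t : ℝ => 1 - Real.exp (-t)) (Real.exp (-t)) t := by
      simpa using ((hasDerivAt_neg t).exp.const_sub 1)
    have e2 := (((hasDerivAt_id t).const_mul (-σ)).exp.mul ((e1.const_mul (-ρ)).exp)).mul (e1.pow m)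
    refine e2.congr_deriv ?_
    simp only [hg, Pi.pow_apply, Pi.mul_apply, id, mul_one]
    rcases m with _ | m
    · simp; ring
    · simp only [Nat.add_sub_cancel]
      push_cast
      have : Real.exp (-t) = 1 - (1 - Real.exp (-t)) := by ring
      generalize 1 - Real.exp (-t) = y at *
      rw [this]
      ring
  have hint := ((hgi (m + 1)).const_mul ρ).sub ((hgi m).const_mul (m + (σ + ρ)))
  have hint' := hint.add ((hgi (m - 1)).const_mul (m : ℝ))
  have hlim : Filter.Tendsto F Filter.atTop (nhds 0) := by
    have h0 : Filter.Tendsto (fun t => Real.exp |ρ| * Real.exp (-σ * t)) Filter.atTop (nhds 0) := by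
      have : Filter.Tendsto (fun t => Real.exp (-σ * t)) Filter.atTop (nhds 0) :=
        Real.tendsto_exp_atBot.comp (Filter.tendsto_id.const_mul_atTop_of_neg (by linarith))
      simpa using this.const_mul (Real.exp |ρ|)
    refine squeeze_zero_norm' ?_ h0
    filter_upwards [Filter.eventually_ge_atTop 0] with t ht
    exact exitIntegrand_le m ht
  have key := integral_Ioi_of_hasDerivAt_of_tendsto' (a := 0) (fun t _ => hd t) hint' hlim
  have hsplit : ∫ t in Set.Ioi (0:ℝ), (ρ * g (m + 1) t - (m + (σ + ρ)) * g m t + m * g (m - 1) t)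
      = ρ * exitIntegral (m + 1) σ ρ - (m + (σ + ρ)) * exitIntegral m σ ρ
        + m * exitIntegral (m - 1) σ ρ := by
    have a1 := integral_add hint ((hgi (m - 1)).const_mul (m : ℝ))
    have a2 := integral_sub ((hgi (m + 1)).const_mul ρ) ((hgi m).const_mul (m + (σ + ρ)))
    simp only [Pi.sub_apply] at a1 a2
    rw [a1, a2, integral_const_mul, integral_const_mul, integral_const_mul]
    rfl
  rw [hsplit] at key
  have hF0 : F 0 = if m = 0 then 1 else 0 := by
    simp [hF, zero_pow_eq]
  rw [hF0] at key
  linarith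

/-! ### Lagrange's expansion of e^{az}/(1-z) -/

/-- The n-th forward difference of x^n is the constant n!. This identity collapses the double series
in the proof of the expansion. -/
theorem sum_antidiagonal_pow_div_factorial (a : ℝ) (n : ℕ) :
    ∑ p ∈ Finset.HasAntidiagonal.antidiagonal n, (a + p.1) ^ n * (-1) ^ p.2 / ((p.1 ! : ℝ) * p.2 !) = 1 := by
  have h := congrFun (fwdDiff_iter_eq_factorial (R := ℝ) (n := n)) a
  rw [fwdDiff_iter_eq_sum_shift] at h
  rw [Finset.Nat.sum_antidiagonal_eq_sum_range_succ
    (fun i j => (a + i) ^ n * (-1) ^ j / ((i ! : ℝ) * j !))]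
  have hn : (n ! : ℝ) ≠ 0 := by positivity
  have h' : ∑ k ∈ Finset.range (n + 1), (a + k) ^ n * (-1) ^ (n - k) / ((k ! : ℝ) * (n - k)!)
      = (∑ k ∈ Finset.range (n + 1),
          ((-1 : ℤ) ^ (n - k) * n.choose k) • (a + k • (1 : ℝ)) ^ n) / n ! := by
    rw [Finset.sum_div]
    refine Finset.sum_congr rfl fun k hk => ?_
    have hk' : k ≤ n := Nat.lt_succ_iff.1 (Finset.mem_range.1 hk)
    rw [zsmul_eq_mul]
    push_cast
    rw [Nat.cast_choose ℝ hk', nsmul_eq_mul, mul_one]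
    field_simp
  rw [h', h]
  simp [hn]

/-- From y^k/k! ≤ e^y at y = a + k. The coefficients grow at most like e^k, so the power series
converges on the disc of radius 1/e. -/
theorem add_nat_pow_div_factorial_le {a : ℝ} (ha : 0 < a) (k : ℕ) :
    (a + k) ^ k / k ! ≤ Real.exp a * Real.exp 1 ^ k := by
  refine (Real.pow_div_factorial_le_exp (a + k) (by positivity) k).trans (le_of_eq ?_)
  rw [Real.exp_add, ← Real.exp_nat_mul, mul_one]

/-- Expand e^{-z(a+k)} to get an absolutely convergent double series: summed by rows it is e^{-az}
times the left side, summed by antidiagonals it is ∑ z^n. -/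
theorem hasSum_add_nat_pow_div_factorial_of_small {a z : ℝ} (ha : 0 < a) (hz : 0 < z)
    (hz' : z < 1 / 8) :
    HasSum (fun k : ℕ => (a + k) ^ k / k ! * (z * Real.exp (-z)) ^ k)
      (Real.exp (a * z) * (1 - z)⁻¹) := by
  set f : ℕ × ℕ → ℝ := fun p => (a + p.1) ^ p.1 * z ^ p.1 / p.1 ! *
    ((-(z * (a + p.1))) ^ p.2 / p.2 !) with hf
  have hq0 : 0 ≤ z * Real.exp (1 + z) := by positivity
  -- The 1/8 comes from z e^{1+z} ≤ z e² together with e² < 8.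
  have hq1 : z * Real.exp (1 + z) < 1 := by
    have h2 : Real.exp (1 + z) ≤ Real.exp (1 + 1) := Real.exp_le_exp.2 (by linarith)
    rw [Real.exp_add 1 1] at h2
    have h3 := Real.exp_one_lt_d9
    nlinarith [Real.exp_pos 1]
  have hnorm : ∀ k, HasSum (fun i => ‖f (k, i)‖)
      ((a + k) ^ k * z ^ k / k ! * Real.exp (z * (a + k))) := by
    intro k
    have h := NormedSpace.expSeries_div_hasSum_exp (𝔸 := ℝ) (z * (a + k))
    rw [← Real.exp_eq_exp_ℝ] at h
    refine (h.mul_left ((a + k) ^ k * z ^ k / k !)).congr_fun ?_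
    intro i
    simp only [hf, norm_mul, norm_div, norm_pow, norm_neg]
    rw [Real.norm_of_nonneg (by positivity : 0 ≤ a + (k : ℝ)), Real.norm_of_nonneg hz.le]
    simp
  have hsum : Summable f := by
    apply Summable.of_norm
    rw [summable_prod_of_nonneg (fun _ => norm_nonneg _)]
    refine ⟨fun k => (hnorm k).summable, ?_⟩
    simp_rw [fun k => (hnorm k).tsum_eq]
    refine Summable.of_nonneg_of_le (fun k => by positivity) (fun k => ?_)
      ((summable_geometric_of_lt_one hq0 hq1).mul_left (Real.exp a * Real.exp (z * a)))
    calc (a + k) ^ k * z ^ k / k ! * Real.exp (z * (a + k))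
        = (a + k) ^ k / k ! * (z ^ k * Real.exp (z * (a + k))) := by ring
      _ ≤ (Real.exp a * Real.exp 1 ^ k) * (z ^ k * Real.exp (z * (a + k))) := by
          gcongr; exact add_nat_pow_div_factorial_le ha k
      _ = _ := by
          rw [mul_pow, Real.exp_add 1 z, mul_pow, ← Real.exp_nat_mul z, mul_add, Real.exp_add,
            mul_comm z (k : ℝ)]
          ring
  have hrow : ∀ k, HasSum (fun i => f (k, i))
      ((a + k) ^ k * z ^ k / k ! * Real.exp (-(z * (a + k)))) := by
    intro k
    have h := NormedSpace.expSeries_div_hasSum_exp (𝔸 := ℝ) (-(z * (a + k)))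
    rw [← Real.exp_eq_exp_ℝ] at h
    exact h.mul_left _
  have h1 := hsum.hasSum.prod_fiberwise hrow
  have h2 : HasSum (fun n : ℕ => z ^ n) (∑' p, f p) := by
    have h3 := (Finset.HasAntidiagonal.sigmaAntidiagonalEquivProd (A := ℕ)).hasSum_iff.2 hsum.hasSum
    refine (h3.sigma (fun n => hasSum_fintype _)).congr_fun ?_
    intro n
    have h4 := sum_antidiagonal_pow_div_factorial a n
    rw [← Finset.sum_coe_sort] at h4
    rw [← mul_one (z ^ n), ← h4, Finset.mul_sum]
    refine Finset.sum_congr rfl fun p _ => ?_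
    have hp : p.1.1 + p.1.2 = n := Finset.HasAntidiagonal.mem_antidiagonal.1 p.2
    simp only [hf, Function.comp, Finset.HasAntidiagonal.sigmaAntidiagonalEquivProd_apply]
    rw [neg_pow (z * _), mul_pow, show z ^ n = _ from hp ▸ pow_add z p.1.1 p.1.2,
      show (a + (p.1.1 : ℝ)) ^ n = _ from hp ▸ pow_add (a + (p.1.1 : ℝ)) p.1.1 p.1.2]
    field_simp
  rw [(hasSum_geometric_of_lt_one hz.le (by linarith)).unique h2]
  refine (h1.mul_left (Real.exp (a * z))).congr_fun ?_
  intro k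
  rw [mul_pow, ← Real.exp_nat_mul, mul_add, neg_add, Real.exp_add]
  have : Real.exp (a * z) * Real.exp (-(z * a)) = 1 := by rw [← Real.exp_add]; simp; ring
  have e : (k : ℝ) * -z = -(z * k) := by ring
  rw [e]
  linear_combination (-((a + k) ^ k * z ^ k / k ! * Real.exp (-(z * k)))) * this

theorem mul_exp_neg_lt_exp_neg_one {z : ℝ} (hz : z < 1) :
    z * Real.exp (-z) < Real.exp (-1) := by
  have h := Real.add_one_lt_exp (x := z - 1) (by linarith)
  have e : Real.exp (-1) = Real.exp (z - 1) * Real.exp (-z) := by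
    rw [← Real.exp_add]; ring_nf
  rw [e]
  exact mul_lt_mul_of_pos_right (by linarith) (Real.exp_pos _)

/-- Lagrange's expansion of `e^{a z} / (1 - z)` in powers of `z e^{-z}`. -/
theorem hasSum_add_nat_pow_div_factorial {a z : ℝ} (ha : 0 < a) (hz : 0 < z) (hz' : z < 1) :
    HasSum (fun k : ℕ => (a + k) ^ k / k ! * (z * Real.exp (-z)) ^ k)
      (Real.exp (a * z) * (1 - z)⁻¹) := by
  -- Analytic continuation from small z: for 0 < z < 1 the point z e^{-z} stays in the disc of
  -- radius 1/e, so both sides are analytic in z on (0, 1), and they agree near 1/16.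
  set p := FormalMultilinearSeries.ofScalars ℝ (fun k : ℕ => (a + k) ^ k / (k ! : ℝ)) with hp
  set r : NNReal := ⟨Real.exp (-1), (Real.exp_pos _).le⟩ with hr
  have hrad : (r : ℝ≥0∞) ≤ p.radius := by
    refine p.le_radius_of_bound (Real.exp a) fun n => ?_
    rw [hp, FormalMultilinearSeries.ofScalars_norm, Real.norm_of_nonneg (by positivity)]
    calc (a + n) ^ n / n ! * (r : ℝ) ^ n ≤ Real.exp a * Real.exp 1 ^ n * (r : ℝ) ^ n := by
          gcongr; exact add_nat_pow_div_factorial_le ha n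
      _ = Real.exp a := by
          have : Real.exp 1 * Real.exp (-1) = 1 := by rw [← Real.exp_add]; simp
          rw [mul_assoc, ← mul_pow, show (r : ℝ) = Real.exp (-1) from rfl, this]
          simp
  have hpos : 0 < p.radius := lt_of_lt_of_le
    (ENNReal.coe_pos.2 (NNReal.coe_pos.1 (show 0 < (r : ℝ) from Real.exp_pos (-1)))) hrad
  have hball := p.hasFPowerSeriesOnBall hpos
  have hmem : ∀ y : ℝ, 0 < y → y < 1 → y * Real.exp (-y) ∈ Metric.eball (0 : ℝ) p.radius := by
    intro y hy hy'
    refine Metric.eball_subset_eball hrad ?_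
    rw [Metric.eball_coe, mem_ball_zero_iff, Real.norm_of_nonneg (by positivity)]
    exact mul_exp_neg_lt_exp_neg_one hy'
  have hs : ∀ y : ℝ, 0 < y → y < 1 →
      HasSum (fun k : ℕ => (a + k) ^ k / k ! * (y * Real.exp (-y)) ^ k)
        (p.sum (y * Real.exp (-y))) := by
    intro y hy hy'
    refine (p.hasSum (hmem y hy hy')).congr_fun fun k => ?_
    rw [hp, FormalMultilinearSeries.ofScalars_apply_eq, smul_eq_mul]
  have hF : AnalyticOnNhd ℝ (fun y => p.sum (y * Real.exp (-y))) (Set.Ioo 0 1) := by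
    intro y hy
    refine AnalyticAt.fun_comp (hball.analyticAt_of_mem (hmem y hy.1 hy.2)) ?_
    fun_prop
  have hG : AnalyticOnNhd ℝ (fun y => Real.exp (a * y) * (1 - y)⁻¹) (Set.Ioo 0 1) := by
    intro y hy
    have : 1 - y ≠ 0 := by linarith [hy.2]
    fun_prop (disch := assumption)
  have heq := hF.eqOn_of_preconnected_of_eventuallyEq hG isPreconnected_Ioo
    (z₀ := 1 / 16) (by norm_num) (by
      filter_upwards [Ioo_mem_nhds (show (0:ℝ) < 1 / 16 by norm_num)
        (show (1:ℝ) / 16 < 1 / 8 by norm_num)] with y hy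
      exact (hs y hy.1 (by linarith [hy.2])).unique
        (hasSum_add_nat_pow_div_factorial_of_small ha hy.1 hy.2))
  have := heq ⟨hz, hz'⟩
  simp only at this
  rw [← this]
  exact hs z hz hz'

/-! ### The order-zero exit integral as a series over the atoms -/

/-- Termwise integration of a series of nonnegative functions with integrable sum. -/
theorem hasSum_integral_of_nonneg_of_hasSum {X : Type*} [MeasurableSpace X] {μ : Measure X}
    {f : ℕ → X → ℝ} {F : X → ℝ} (hf : ∀ k, Integrable (f k) μ)
    (hf0 : ∀ k, ∀ᵐ x ∂μ, 0 ≤ f k x) (hF : Integrable F μ)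
    (hsum : ∀ᵐ x ∂μ, HasSum (fun k => f k x) (F x)) :
    HasSum (fun k => ∫ x, f k x ∂μ) (∫ x, F x ∂μ) := by
  have hnn : ∀ᵐ x ∂μ, ∀ k, 0 ≤ f k x := ae_all_iff.2 hf0
  have hs : Summable fun k => ∫ x, ‖f k x‖ ∂μ := by
    refine summable_of_sum_range_le (c := ∫ x, F x ∂μ)
      (fun k => integral_nonneg fun x => norm_nonneg _) fun n => ?_
    rw [← integral_finsetSum _ fun k _ => (hf k).norm]
    refine integral_mono_ae (integrable_finsetSum _ fun k _ => (hf k).norm) hF ?_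
    filter_upwards [hnn, hsum] with x hx hx'
    simp only [fun k => Real.norm_of_nonneg (hx k)]
    exact sum_le_hasSum _ (fun k _ => hx k) hx'
  have h := hasSum_integral_of_summable_integral_norm hf hs
  have e : ∫ x, F x ∂μ = ∫ x, ∑' k, f k x ∂μ := by
    refine integral_congr_ae ?_
    filter_upwards [hsum] with x hx
    exact hx.tsum_eq.symm
  rwa [e]

/-- The integrand is the derivative of -e^{-b(t+e^{-t})}/b. The exponent arises because z e^{-z} =
e^{-(t+e^{-t})} at z = e^{-t}. -/
theorem integral_exp_mul_add_exp_neg {b : ℝ} (hb : 0 < b) :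
    IntegrableOn (fun t => (1 - Real.exp (-t)) * Real.exp (-b * (t + Real.exp (-t))))
      (Set.Ioi 0) ∧
    ∫ t in Set.Ioi (0 : ℝ), (1 - Real.exp (-t)) * Real.exp (-b * (t + Real.exp (-t)))
      = Real.exp (-b) / b := by
  have hi : IntegrableOn (fun t => (1 - Real.exp (-t)) * Real.exp (-b * (t + Real.exp (-t))))
      (Set.Ioi 0) := by
    refine Integrable.mono' (exp_neg_integrableOn_Ioi 0 hb) ?_ ?_
    · exact Continuous.aestronglyMeasurable (by fun_prop)
    · filter_upwards [ae_restrict_mem measurableSet_Ioi] with t ht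
      obtain ⟨h0, h1⟩ := one_sub_exp_neg_mem_Icc (le_of_lt (Set.mem_Ioi.1 ht))
      rw [Real.norm_of_nonneg (by positivity)]
      refine (mul_le_of_le_one_left (by positivity) h1).trans (Real.exp_le_exp.2 ?_)
      nlinarith [mul_pos hb (Real.exp_pos (-t))]
  refine ⟨hi, ?_⟩
  have hd : ∀ t : ℝ, HasDerivAt (fun t => -(Real.exp (-b * (t + Real.exp (-t))) / b))
      ((1 - Real.exp (-t)) * Real.exp (-b * (t + Real.exp (-t)))) t := by
    intro t
    have e1 := (((hasDerivAt_id t).add (hasDerivAt_neg t).exp).const_mul (-b)).exp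
    refine ((e1.div_const b).neg).congr_deriv ?_
    simp
    field_simp
    ring
  have hlim : Filter.Tendsto (fun t => -(Real.exp (-b * (t + Real.exp (-t))) / b)) Filter.atTop
      (nhds 0) := by
    have h0 : Filter.Tendsto (fun t => Real.exp (-b * t) / b) Filter.atTop (nhds 0) := by
      have : Filter.Tendsto (fun t => Real.exp (-b * t)) Filter.atTop (nhds 0) :=
        Real.tendsto_exp_atBot.comp (Filter.tendsto_id.const_mul_atTop_of_neg (by linarith))
      simpa using this.div_const b
    refine squeeze_zero_norm (fun t => ?_) h0
    rw [norm_neg, Real.norm_of_nonneg (by positivity)]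
    gcongr ?_ / b
    refine Real.exp_le_exp.2 ?_
    nlinarith [mul_pos hb (Real.exp_pos (-t))]
  rw [integral_Ioi_of_hasDerivAt_of_tendsto' (fun t _ => hd t) hi hlim]
  simp

/-- Put z = e^{-t} in Lagrange's expansion and multiply by e^{b-a}(1-z)e^{-b(t+z)}: the factor 1 - z
cancels the pole, the sum becomes the exit integrand, and each term is integrable in closed form. -/
theorem hasSum_exitIntegral_zero {a b : ℝ} (ha : 0 < a) (hb : 0 < b) :
    HasSum (fun k : ℕ => (a + k) ^ k / k ! * Real.exp (-(a + k)) / (b + k))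
      (exitIntegral 0 b (a - b)) := by
  have hbk : ∀ k : ℕ, 0 < b + k := fun k => by positivity
  set f : ℕ → ℝ → ℝ := fun k t => ((a + k) ^ k / k ! * Real.exp (b - a)) *
    ((1 - Real.exp (-t)) * Real.exp (-(b + k) * (t + Real.exp (-t)))) with hf
  have key := hasSum_integral_of_nonneg_of_hasSum (μ := volume.restrict (Set.Ioi (0:ℝ)))
    (f := f) (F := fun t => Real.exp (-b * t) * Real.exp (-(a - b) * (1 - Real.exp (-t))) *
      (1 - Real.exp (-t)) ^ 0)
    (fun k => (integral_exp_mul_add_exp_neg (hbk k)).1.const_mul _)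
    (fun k => by
      filter_upwards [ae_restrict_mem measurableSet_Ioi] with t ht
      have h0 := (one_sub_exp_neg_mem_Icc (le_of_lt (Set.mem_Ioi.1 ht))).1
      simp only [hf]
      positivity)
    (integrableOn_exitIntegrand 0 (a - b) hb)
    (by
      filter_upwards [ae_restrict_mem measurableSet_Ioi] with t ht
      have hz : Real.exp (-t) < 1 := Real.exp_lt_one_iff.2 (by simpa using ht)
      have h := hasSum_add_nat_pow_div_factorial ha (Real.exp_pos (-t)) hz
      have h' := h.mul_left (Real.exp (b - a) * (1 - Real.exp (-t)) *
        Real.exp (-b * (t + Real.exp (-t))))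
      have e : Real.exp (-b * t) * Real.exp (-(a - b) * (1 - Real.exp (-t))) *
          (1 - Real.exp (-t)) ^ 0 = Real.exp (b - a) * (1 - Real.exp (-t)) *
          Real.exp (-b * (t + Real.exp (-t))) *
            (Real.exp (a * Real.exp (-t)) * (1 - Real.exp (-t))⁻¹) := by
        have h1 : (1 - Real.exp (-t)) ≠ 0 := by linarith
        have h2 : Real.exp (-b * t) * Real.exp (-(a - b) * (1 - Real.exp (-t)))
          = Real.exp (b - a) * Real.exp (-b * (t + Real.exp (-t))) *
            Real.exp (a * Real.exp (-t)) := by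
          rw [← Real.exp_add, ← Real.exp_add, ← Real.exp_add]
          ring_nf
        rw [h2]
        field_simp
      rw [e]
      refine h'.congr_fun fun k => ?_
      simp only [hf]
      have h3 : Real.exp (-(b + k) * (t + Real.exp (-t))) =
          Real.exp (-b * (t + Real.exp (-t))) * (Real.exp (-t) * Real.exp (-Real.exp (-t))) ^ k := by
        rw [← Real.exp_add, ← Real.exp_nat_mul, ← Real.exp_add]
        ring_nf
      rw [h3]
      ring)
  refine key.congr_fun fun k => ?_
  rw [hf, integral_const_mul, (integral_exp_mul_add_exp_neg (hbk k)).2]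
  have : Real.exp (-(a + k)) = Real.exp (b - a) * Real.exp (-(b + k)) := by
    rw [← Real.exp_add]; ring_nf
  rw [this]
  ring

/-! ### Charlier polynomials against the Poisson weights -/

/-- Two-step form of the recurrence of the Charlier polynomials. -/
theorem charlier_succ_succ {a : ℝ} (ha : a ≠ 0) (n : ℕ) (x : ℝ) :
    a * charlier a (n + 2) x =
      (n + 1 + a - x) * charlier a (n + 1) x - (n + 1) * charlier a n x := by
  rw [charlier]
  push_cast
  field_simp

/-- Lowering and raising relations of the Charlier polynomials. -/
theorem charlier_sub_one {a : ℝ} (ha : a ≠ 0) (n : ℕ) (x : ℝ) :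
    a * charlier a (n + 1) x = a * charlier a n x - x * charlier a n (x - 1) ∧
    a * (charlier a (n + 1) x - charlier a (n + 1) (x - 1))
      = -(n + 1) * charlier a n (x - 1) := by
  -- Joint induction: lowering at n + 1 uses both relations at n, and raising at n + 1 uses the new
  -- lowering relation.
  induction n with
  | zero =>
    simp only [charlier]
    constructor
    · field_simp
    · field_simp; push_cast; ring
  | succ n ih =>
    obtain ⟨h1, h2⟩ := ih
    have h3 := charlier_succ_succ ha n x
    have h4 := charlier_succ_succ ha n (x - 1)
    have h5 : a * charlier a (n + 2) x
        = a * charlier a (n + 1) x - x * charlier a (n + 1) (x - 1) := by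
      apply mul_left_cancel₀ ha
      linear_combination a * h3 + (n + 1) * h1 - x * h2
    refine ⟨h5, ?_⟩
    push_cast
    linear_combination h5 - h4 + h2

theorem continuous_charlier (a : ℝ) : ∀ n, Continuous (charlier a n)
  | 0 => by simp only [charlier]; fun_prop
  | 1 => by simp only [charlier]; fun_prop
  | n + 2 => by
    have h1 := continuous_charlier a n
    have h2 := continuous_charlier a (n + 1)
    simp only [charlier]
    fun_prop

/-- Against the Poisson weights, `C_n(k; a) / (s + k)` sums to the exit integral. -/
theorem hasSum_charlier_div {a : ℝ} (ha : 0 < a) (n : ℕ) : ∀ {s : ℝ}, 0 < s →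
    HasSum (fun k : ℕ => Real.exp (-a) * a ^ k / k ! * (charlier a n k / (s + k)))
      (exitIntegral n s a) ∧
    Summable (fun k : ℕ => ‖Real.exp (-a) * a ^ k / k ! * (charlier a n k / (s + k))‖) := by
  suffices h : ∀ {s : ℝ}, 0 < s →
      HasSum (fun k : ℕ => Real.exp (-a) * a ^ k / k ! * (charlier a n k / (s + k)))
        (exitIntegral n s a) from
      fun {_} hs => ⟨h hs, (h hs).summable.norm⟩
  induction n with
  | zero =>
    intro s hs
    have hsk : ∀ k : ℕ, 0 < s + k := fun k => by positivity
    -- Base case: 1/(s+k) = ∫ e^{-(s+k)t} dt, and the Poisson sum under the integral is e^{-a}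
    -- e^{-st} e^{a e^{-t}}.
    have hi : ∀ k : ℕ, IntegrableOn (fun t => Real.exp (-(s + k) * t)) (Set.Ioi 0) :=
      fun k => exp_neg_integrableOn_Ioi 0 (hsk k)
    have hsum := hasSum_integral_of_summable_integral_norm
      (μ := volume.restrict (Set.Ioi (0:ℝ)))
      (F := fun (k : ℕ) t => Real.exp (-a) * a ^ k / k ! * Real.exp (-(s + k) * t))
      (fun k => (hi k).const_mul _) (by
        have h1 := (NormedSpace.expSeries_div_hasSum_exp (𝔸 := ℝ) a).summable
        refine Summable.of_nonneg_of_le (fun k => integral_nonneg fun _ => norm_nonneg _)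
          (fun k => ?_) (h1.mul_left (Real.exp (-a) / s))
        simp only [norm_mul, integral_const_mul, Real.norm_of_nonneg (Real.exp_pos _).le]
        rw [integral_exp_mul_Ioi (by linarith [hsk k])]
        rw [Real.norm_of_nonneg (by positivity)]
        simp only [mul_zero, Real.exp_zero]
        have h2 : -1 / -(s + k) ≤ 1 / s := by
          rw [neg_div_neg_eq]
          exact one_div_le_one_div_of_le hs (by linarith [Nat.cast_nonneg (α := ℝ) k])
        calc _ ≤ Real.exp (-a) * a ^ k / k ! * (1 / s) := by gcongr
          _ = _ := by ring)
    have e : exitIntegral 0 s a = ∫ t in Set.Ioi (0 : ℝ),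
        ∑' k : ℕ, Real.exp (-a) * a ^ k / k ! * Real.exp (-(s + k) * t) := by
      unfold exitIntegral
      congr 1
      ext t
      have h1 := NormedSpace.expSeries_div_hasSum_exp (𝔸 := ℝ) (a * Real.exp (-t))
      rw [← Real.exp_eq_exp_ℝ] at h1
      have h2 := h1.mul_left (Real.exp (-a) * Real.exp (-s * t))
      have h3 : Real.exp (-s * t) * Real.exp (-a * (1 - Real.exp (-t))) * (1 - Real.exp (-t)) ^ 0
          = Real.exp (-a) * Real.exp (-s * t) * Real.exp (a * Real.exp (-t)) := by
        rw [pow_zero, mul_one, ← Real.exp_add, ← Real.exp_add, ← Real.exp_add]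
        ring_nf
      rw [h3, ← h2.tsum_eq]
      refine tsum_congr fun k => ?_
      rw [mul_pow, ← Real.exp_nat_mul, show -(s + k) * t = -s * t + k * -t by ring, Real.exp_add]
      ring
    rw [e]
    refine hsum.congr_fun fun k => ?_
    rw [integral_const_mul, integral_exp_mul_Ioi (by linarith [hsk k])]
    rw [mul_zero, Real.exp_zero, neg_div_neg_eq, charlier]
  | succ n ih =>
    intro s hs
    rw [exitIntegral_succ n a hs]
    have h1 := ih (s := s + 1) (by linarith)
    -- The lowering term k C_n(k-1)/a vanishes at k = 0; after the shift k ↦ k + 1 it is the sum for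
    -- C_n with s + 1 in place of s.
    have h2 : HasSum (fun k : ℕ => Real.exp (-a) * a ^ k / k ! *
        (k * charlier a n (k - 1) / (a * (s + k)))) (exitIntegral n (s + 1) a) := by
      rw [← hasSum_nat_add_iff' 1]
      simp only [Finset.sum_range_one, Nat.cast_zero, zero_mul, zero_div, mul_zero, sub_zero]
      refine h1.congr_fun fun k => ?_
      have h3 : s + 1 + (k : ℝ) ≠ 0 := by positivity
      have h4 : s + ((k : ℝ) + 1) ≠ 0 := by positivity
      rw [Nat.factorial_succ]
      push_cast
      rw [add_sub_cancel_right, show s + ((k : ℝ) + 1) = s + 1 + k by ring]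
      field_simp
      ring
    refine ((ih hs).sub h2).congr_fun fun k => ?_
    have h5 := (charlier_sub_one ha.ne' n (k : ℝ)).1
    have h6 : charlier a (n + 1) k = charlier a n k - k * charlier a n (k - 1) / a := by
      field_simp
      linarith
    have h3 : s + (k : ℝ) ≠ 0 := by positivity
    rw [h6]
    field_simp

theorem integrable_charlier_div {a : ℝ} (ha : 0 < a) (n : ℕ) {s : ℝ} (hs : 0 < s) :
    IntegrableOn (fun x => charlier a n x / (s + x)) (Set.Ici 0) (poissonOnReal a) ∧
    ∫ x in Set.Ici 0, charlier a n x / (s + x) ∂(poissonOnReal a) = exitIntegral n s a := by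
  obtain ⟨h1, h2⟩ := hasSum_charlier_div ha n hs
  have hm : Measurable fun x => charlier a n x / (s + x) :=
    (continuous_charlier a n).measurable.div (by fun_prop)
  have hres : (poissonOnReal a).restrict (Set.Ici 0) = poissonOnReal a := by
    refine Measure.restrict_eq_self_of_ae_mem ?_
    unfold poissonOnReal
    refine (ae_map_iff (f := (Nat.cast : ℕ → ℝ)) (by fun_prop) measurableSet_Ici).2 ?_
    exact Filter.Eventually.of_forall fun k => Nat.cast_nonneg k
  have hI : Integrable (fun k : ℕ => charlier a n k / (s + k)) (poissonMeasure a.toNNReal) := by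
    rw [integrable_poissonMeasure_iff]
    refine h2.congr fun k => ?_
    rw [norm_mul, Real.norm_of_nonneg (by positivity), Real.coe_toNNReal a ha.le]
  rw [IntegrableOn, hres]
  unfold poissonOnReal
  refine ⟨(integrable_map_measure hm.aestronglyMeasurable (by fun_prop)).2 hI, ?_⟩
  rw [integral_map (by fun_prop) hm.aestronglyMeasurable, integral_poissonMeasure]
  simp only [Real.coe_toNNReal a ha.le, smul_eq_mul]
  exact h1.tsum_eq

/-! ### The spectral measure and its transforms -/

theorem queuePoly_succ {ρ : ℝ} (σ : ℝ) (hρ : 0 < ρ) (n : ℕ) (x : ℝ) :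
    ρ * queuePoly ρ σ (n + 1) x
      = (n + (σ + ρ)) * (x * queuePoly ρ σ n x) - n * queuePoly ρ σ (n - 1) x := by
  have h := queuePoly_rec ρ σ hρ n x
  rcases n with _ | n
  · simp at h ⊢; linarith
  · simp at h ⊢; linarith

theorem continuous_queuePoly (ρ σ : ℝ) : ∀ n, Continuous (queuePoly ρ σ n)
  | 0 => by simp only [queuePoly]; fun_prop
  | 1 => by simp only [queuePoly]; fun_prop
  | n + 2 => by
    have h1 := continuous_queuePoly ρ σ n
    have h2 := continuous_queuePoly ρ σ (n + 1)
    simp only [queuePoly]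
    fun_prop

theorem spectralMass_eq (ρ σ : ℝ) (k : ℕ) :
    spectralMass ρ σ k = (σ + ρ) / 2 *
      ((σ + ρ + k) ^ k / k ! * Real.exp (-(σ + ρ + k)) / (σ + ρ + k)) := by
  unfold spectralMass
  field_simp

theorem spectralMass_nonneg {ρ σ : ℝ} (hρ : 0 < ρ) (hσ : 0 < σ) (k : ℕ) :
    0 ≤ spectralMass ρ σ k := by
  unfold spectralMass; positivity

/-- The case a = b = σ + ρ of the series, whose sum is then ∫ e^{-at} dt = 1/a. -/
theorem hasSum_two_mul_spectralMass {ρ σ : ℝ} (hρ : 0 < ρ) (hσ : 0 < σ) :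
    HasSum (fun k => 2 * spectralMass ρ σ k) 1 := by
  have ha : 0 < σ + ρ := by linarith
  have h := (hasSum_exitIntegral_zero ha ha).mul_left (σ + ρ)
  rw [sub_self, exitIntegral_zero_zero ha, mul_one_div_cancel ha.ne'] at h
  refine h.congr_fun fun k => ?_
  rw [spectralMass_eq]; ring

theorem isProbabilityMeasure_spectralMeasure {ρ σ : ℝ} (hρ : 0 < ρ) (hσ : 0 < σ) :
    IsProbabilityMeasure (spectralMeasure ρ σ) := by
  refine ⟨?_⟩
  have h := hasSum_two_mul_spectralMass hρ hσ
  rw [spectralMeasure, Measure.sum_apply _ MeasurableSet.univ]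
  have e : ∀ k, (ENNReal.ofReal (spectralMass ρ σ k) •
      (Measure.dirac (spectralAtom ρ σ k) + Measure.dirac (-spectralAtom ρ σ k))) Set.univ
      = ENNReal.ofReal (2 * spectralMass ρ σ k) := by
    intro k
    simp [two_mul, ENNReal.ofReal_add, spectralMass_nonneg hρ hσ]
  simp_rw [e]
  rw [← ENNReal.ofReal_tsum_of_nonneg
    (fun k => mul_nonneg (by norm_num) (spectralMass_nonneg hρ hσ k)) h.summable, h.tsum_eq]
  simp

/-- Positivity of σ keeps the support at a positive distance from 1, hence 1/(1-x) bounded on it. -/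
theorem spectralAtom_zero_lt_one {ρ σ : ℝ} (hρ : 0 < ρ) (hσ : 0 < σ) :
    spectralAtom ρ σ 0 < 1 := by
  unfold spectralAtom
  rw [Real.sqrt_lt' one_pos, div_lt_iff₀ (by positivity)]
  simpa using hσ

theorem spectralAtom_le {ρ σ : ℝ} (hρ : 0 < ρ) (hσ : 0 < σ) (k : ℕ) :
    spectralAtom ρ σ k ≤ spectralAtom ρ σ 0 := by
  unfold spectralAtom
  gcongr
  exact Nat.zero_le k

theorem ae_spectralMeasure_abs_le {ρ σ : ℝ} (hρ : 0 < ρ) (hσ : 0 < σ) :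
    ∀ᵐ x ∂(spectralMeasure ρ σ), |x| ≤ spectralAtom ρ σ 0 := by
  have hm : MeasurableSet {x : ℝ | |x| ≤ spectralAtom ρ σ 0} :=
    measurableSet_le (by fun_prop) (by fun_prop)
  rw [spectralMeasure, Measure.ae_sum_iff' hm]
  intro k
  refine Measure.ae_smul_measure ?_ _
  have h0 : 0 ≤ spectralAtom ρ σ k := Real.sqrt_nonneg _
  rw [ae_add_measure_iff, ae_dirac_iff hm, ae_dirac_iff hm, abs_neg, abs_of_nonneg h0]
  exact ⟨spectralAtom_le hρ hσ k, spectralAtom_le hρ hσ k⟩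

/-- The resolvent quotients `P_n(x) / (1 - s x)`, `0 ≤ s ≤ 1`, are uniformly bounded on the support
of the spectral measure. -/
theorem exists_ae_norm_queuePoly_div_le {ρ σ : ℝ} (hρ : 0 < ρ) (hσ : 0 < σ) (n : ℕ) :
    ∃ C, ∀ᵐ x ∂(spectralMeasure ρ σ), ∀ s ∈ Set.Icc (0 : ℝ) 1,
      0 < 1 - s * x ∧ ‖queuePoly ρ σ n x / (1 - s * x)‖ ≤ C := by
  obtain ⟨C, hC⟩ := (isCompact_Icc (a := (-1 : ℝ)) (b := 1)).exists_bound_of_continuousOn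
    (continuous_queuePoly ρ σ n).continuousOn
  have h1 := spectralAtom_zero_lt_one hρ hσ
  refine ⟨C / (1 - spectralAtom ρ σ 0), ?_⟩
  filter_upwards [ae_spectralMeasure_abs_le hρ hσ] with x hx s hs
  obtain ⟨hx1, hx2⟩ := abs_le.1 hx
  have h2 : s * x ≤ spectralAtom ρ σ 0 := by
    have h0 : 0 ≤ spectralAtom ρ σ 0 := Real.sqrt_nonneg _
    nlinarith [hs.1, hs.2]
  have h3 : 0 < 1 - s * x := by linarith
  have h4 := hC x ⟨by linarith, by linarith⟩
  refine ⟨h3, ?_⟩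
  rw [norm_div, Real.norm_of_nonneg h3.le]
  exact div_le_div₀ ((norm_nonneg _).trans h4) h4 (by linarith) (by linarith)

theorem measurable_queuePoly_div (ρ σ : ℝ) (n : ℕ) (s : ℝ) :
    Measurable fun x => queuePoly ρ σ n x / (1 - s * x) :=
  (continuous_queuePoly ρ σ n).measurable.div (by fun_prop)

theorem integrable_queuePoly_div {ρ σ : ℝ} (hρ : 0 < ρ) (hσ : 0 < σ) (n : ℕ) {s : ℝ}
    (hs : s ∈ Set.Icc (0 : ℝ) 1) :
    Integrable (fun x => queuePoly ρ σ n x / (1 - s * x)) (spectralMeasure ρ σ) := by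
  have := isProbabilityMeasure_spectralMeasure hρ hσ
  obtain ⟨C, hC⟩ := exists_ae_norm_queuePoly_div_le hρ hσ n
  exact Integrable.of_bound (measurable_queuePoly_div ρ σ n s).aestronglyMeasurable C
    (hC.mono fun x hx => (hx s hs).2)

theorem integrable_queuePoly {ρ σ : ℝ} (hρ : 0 < ρ) (hσ : 0 < σ) (n : ℕ) :
    Integrable (queuePoly ρ σ n) (spectralMeasure ρ σ) := by
  simpa using integrable_queuePoly_div hρ hσ n (s := 0) (by simp)

/-- The generating function `∫ P_n(x) / (1 - s x) dψ(x)`. -/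
noncomputable def spectralTransform (ρ σ : ℝ) (n : ℕ) (s : ℝ) : ℝ :=
  ∫ x, queuePoly ρ σ n x / (1 - s * x) ∂(spectralMeasure ρ σ)

theorem tendsto_spectralTransform {ρ σ : ℝ} (hρ : 0 < ρ) (hσ : 0 < σ) (n : ℕ) :
    Filter.Tendsto (spectralTransform ρ σ n) (nhdsWithin 0 (Set.Ioc 0 1))
      (nhds (∫ x, queuePoly ρ σ n x ∂(spectralMeasure ρ σ))) := by
  have := isProbabilityMeasure_spectralMeasure hρ hσ
  obtain ⟨C, hC⟩ := exists_ae_norm_queuePoly_div_le hρ hσ n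
  refine tendsto_integral_filter_of_dominated_convergence (fun _ => C) ?_ ?_
    (integrable_const C) ?_
  · exact Filter.Eventually.of_forall
      fun s => (measurable_queuePoly_div ρ σ n s).aestronglyMeasurable
  · filter_upwards [self_mem_nhdsWithin] with s hs
    exact hC.mono fun x hx => (hx s ⟨hs.1.le, hs.2⟩).2
  · refine Filter.Eventually.of_forall fun x => Filter.Tendsto.mono_left ?_ nhdsWithin_le_nhds
    have : ContinuousAt (fun s => queuePoly ρ σ n x / (1 - s * x)) 0 :=
      ContinuousAt.div (by fun_prop) (by fun_prop) (by simp)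
    simpa [ContinuousAt] using this

/-- The two atoms ±x of index k add up to 2/(1-s²x²) = 2(σ+ρ+k)/(σ+ρ+k-s²ρ). The numerator cancels
the denominator of the mass, leaving the series with a = σ + ρ and b = a - s²ρ. -/
theorem spectralTransform_zero {ρ σ : ℝ} (hρ : 0 < ρ) (hσ : 0 < σ) {s : ℝ}
    (hs : s ∈ Set.Ioc (0 : ℝ) 1) :
    spectralTransform ρ σ 0 s
      = (σ + ρ) * exitIntegral 0 (σ + ρ - s ^ 2 * ρ) (s ^ 2 * ρ) := by
  have ha : 0 < σ + ρ := by linarith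
  have hs2 : s ^ 2 ≤ 1 := pow_le_one₀ hs.1.le hs.2
  have hb : 0 < σ + ρ - s ^ 2 * ρ := by nlinarith
  have hint := integrable_queuePoly_div hρ hσ 0 (s := s) ⟨hs.1.le, hs.2⟩
  have h1 := hasSum_integral_measure hint
  have h2 := (hasSum_exitIntegral_zero ha hb).mul_left (σ + ρ)
  rw [sub_sub_cancel] at h2
  refine h1.unique (h2.congr_fun fun k => ?_)
  have hk0 : 0 ≤ spectralAtom ρ σ k := Real.sqrt_nonneg _
  have hk1 : spectralAtom ρ σ k < 1 :=
    (spectralAtom_le hρ hσ k).trans_lt (spectralAtom_zero_lt_one hρ hσ)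
  have hk2 : spectralAtom ρ σ k ^ 2 = ρ / (σ + ρ + k) := Real.sq_sqrt (by positivity)
  have hlt : s * spectralAtom ρ σ k < 1 := by nlinarith [hs.1, hs.2]
  have hge : 0 ≤ s * spectralAtom ρ σ k := mul_nonneg hs.1.le hk0
  have e1 : (1 : ℝ) - s * spectralAtom ρ σ k ≠ 0 := by linarith
  have e2 : (1 : ℝ) - s * -spectralAtom ρ σ k ≠ 0 := by
    rw [mul_neg]; linarith
  have hak : 0 < σ + ρ + (k : ℝ) := by positivity
  have hbk : 0 < σ + ρ - s ^ 2 * ρ + k := by positivity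
  rw [integral_smul_measure, integral_add_measure (integrable_dirac (by simp))
    (integrable_dirac (by simp)), integral_dirac, integral_dirac,
    ENNReal.toReal_ofReal (spectralMass_nonneg hρ hσ k), spectralMass_eq, smul_eq_mul]
  have e3 : queuePoly ρ σ 0 (spectralAtom ρ σ k) / (1 - s * spectralAtom ρ σ k) +
      queuePoly ρ σ 0 (-spectralAtom ρ σ k) / (1 - s * -spectralAtom ρ σ k)
      = 2 * (σ + ρ + k) / (σ + ρ - s ^ 2 * ρ + k) := by
    simp only [queuePoly]
    rw [div_add_div _ _ e1 e2, div_eq_div_iff (mul_ne_zero e1 e2) hbk.ne']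
    have e4 : spectralAtom ρ σ k ^ 2 * (σ + ρ + k) = ρ := by rw [hk2]; field_simp
    linear_combination (2 * s ^ 2) * e4
  rw [e3]
  field_simp

/-- Divide the recurrence of the P_n by 1 - sx and use sx/(1-sx) = 1/(1-sx) - 1; the -1 produces the
moment ∫ P_n dψ. -/
theorem spectralTransform_succ {ρ σ : ℝ} (hρ : 0 < ρ) (hσ : 0 < σ) (n : ℕ) {s : ℝ}
    (hs : s ∈ Set.Ioc (0 : ℝ) 1) :
    s * (ρ * spectralTransform ρ σ (n + 1) s) = (n + (σ + ρ)) * (spectralTransform ρ σ n s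
      - ∫ x, queuePoly ρ σ n x ∂(spectralMeasure ρ σ))
      - s * (n * spectralTransform ρ σ (n - 1) s) := by
  have hs' : s ∈ Set.Icc (0 : ℝ) 1 := ⟨hs.1.le, hs.2⟩
  have i1 := integrable_queuePoly_div hρ hσ n hs'
  have i2 := integrable_queuePoly hρ hσ n
  have i3 := integrable_queuePoly_div hρ hσ (n - 1) hs'
  have i4 := integral_sub ((i1.sub i2).const_mul (n + (σ + ρ))) ((i3.const_mul (n : ℝ)).const_mul s)
  simp only [Pi.sub_apply] at i4
  unfold spectralTransform
  rw [← integral_sub i1 i2, ← integral_const_mul, ← integral_const_mul, ← integral_const_mul,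
    ← integral_const_mul, ← integral_const_mul, ← i4]
  refine integral_congr_ae ?_
  obtain ⟨C, hC⟩ := exists_ae_norm_queuePoly_div_le hρ hσ n
  filter_upwards [hC] with x hx
  have h1 := (hx s hs').1.ne'
  have h2 := queuePoly_succ σ hρ n x
  field_simp
  linear_combination s * h2

/-- Closed form of the spectral transforms; letting `s → 0` in it yields the orthogonality of the
`P_n` to the constants, which is what the recurrence needs. -/
theorem spectralTransform_eq {ρ σ : ℝ} (hρ : 0 < ρ) (hσ : 0 < σ) (n : ℕ) :
    (∀ s ∈ Set.Ioc (0 : ℝ) 1, spectralTransform ρ σ n s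
      = (σ + ρ) * (s ^ n * exitIntegral n (σ + ρ - s ^ 2 * ρ) (s ^ 2 * ρ))) ∧
    (∀ s ∈ Set.Ioc (0 : ℝ) 1, spectralTransform ρ σ (n - 1) s
      = (σ + ρ) * (s ^ (n - 1) * exitIntegral (n - 1) (σ + ρ - s ^ 2 * ρ) (s ^ 2 * ρ))) := by
  induction n with
  | zero =>
    have h : ∀ s ∈ Set.Ioc (0 : ℝ) 1, spectralTransform ρ σ 0 s
      = (σ + ρ) * (s ^ 0 * exitIntegral 0 (σ + ρ - s ^ 2 * ρ) (s ^ 2 * ρ)) := fun s hs => by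
        rw [spectralTransform_zero hρ hσ hs, pow_zero, one_mul]
    exact ⟨h, h⟩
  | succ n ih =>
    refine ⟨fun s hs => ?_, ih.1⟩
    have hbound : ∀ s ∈ Set.Ioc (0 : ℝ) 1, s ^ 2 * ρ ≤ ρ := fun s hs => by
      have : s ^ 2 ≤ 1 := pow_le_one₀ hs.1.le hs.2
      nlinarith
    -- For n ≥ 1 the induction hypothesis bounds the transform by a constant times s^n, and its
    -- limit at s = 0 is the moment. The constant e^ρ/σ comes from s²ρ ≤ ρ and σ + ρ - s²ρ ≥ σ.
    have horth : ∫ x, queuePoly ρ σ n x ∂(spectralMeasure ρ σ) = if n = 0 then 1 else 0 := by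
      split_ifs with hn
      · have := isProbabilityMeasure_spectralMeasure hρ hσ
        subst hn
        simp [queuePoly]
      · have : (nhdsWithin (0 : ℝ) (Set.Ioc 0 1)).NeBot := by
          rw [← mem_closure_iff_nhdsWithin_neBot, closure_Ioc (by norm_num)]
          simp
        refine tendsto_nhds_unique (tendsto_spectralTransform hρ hσ n) ?_
        have h0 : Filter.Tendsto (fun s : ℝ => (σ + ρ) * (s ^ n * (Real.exp ρ / σ)))
            (nhdsWithin 0 (Set.Ioc 0 1)) (nhds 0) := by
          refine Filter.Tendsto.mono_left ?_ nhdsWithin_le_nhds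
          have : Continuous fun s : ℝ => (σ + ρ) * (s ^ n * (Real.exp ρ / σ)) := by fun_prop
          simpa [hn] using this.tendsto 0
        refine squeeze_zero_norm' ?_ h0
        filter_upwards [self_mem_nhdsWithin] with s hs
        have hb := hbound s hs
        have hb0 : 0 ≤ s ^ 2 * ρ := by positivity
        rw [ih.1 s hs, norm_mul, norm_mul, norm_pow, Real.norm_of_nonneg hs.1.le,
          Real.norm_of_nonneg (by positivity : 0 ≤ σ + ρ)]
        have hs0 := hs.1.le
        gcongr
        refine (norm_exitIntegral_le n (s ^ 2 * ρ) (by linarith)).trans ?_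
        rw [abs_of_nonneg hb0]
        gcongr
        linarith
    have h1 := spectralTransform_succ hρ hσ n hs
    -- The two parameters add up to σ + ρ whatever s is, so the middle coefficient is that of the
    -- P_n.
    have h2 := exitIntegral_rec n (σ := σ + ρ - s ^ 2 * ρ) (s ^ 2 * ρ)
      (by linarith [hbound s hs])
    rw [sub_add_cancel] at h2
    rw [horth, ih.1 s hs, ih.2 s hs] at h1
    have hsρ : s * ρ ≠ 0 := mul_ne_zero hs.1.ne' hρ.ne'
    apply mul_left_cancel₀ hsρ
    rcases n with _ | n
    · simp only [CharP.cast_eq_zero, if_true] at h1 h2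
      linear_combination h1 - (σ + ρ) * h2
    · simp only [Nat.add_eq_zero_iff, one_ne_zero, and_false, if_false,
        Nat.add_sub_cancel] at h1 h2
      linear_combination h1 - (σ + ρ) * s ^ (n + 1) * h2

theorem integral_queuePoly_div {ρ σ : ℝ} (hρ : 0 < ρ) (hσ : 0 < σ) (n : ℕ) :
    ∫ x, queuePoly ρ σ n x / (1 - x) ∂(spectralMeasure ρ σ)
      = (σ + ρ) * exitIntegral n σ ρ := by
  have h := (spectralTransform_eq hρ hσ n).1 1 (by simp)
  simpa [spectralTransform] using h

/-! ### Exponential laws -/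

theorem expMeasure_eq_withDensity (r : ℝ) :
    expMeasure r = volume.withDensity (exponentialPDF r) := rfl

theorem measurable_exponentialPDF (r : ℝ) : Measurable (exponentialPDF r) :=
  (measurable_exponentialPDFReal r).ennreal_ofReal

theorem integral_expMeasure {r : ℝ} (hr : 0 < r) (f : ℝ → ℝ) :
    ∫ x, f x ∂(expMeasure r) = ∫ x in Set.Ioi (0 : ℝ), r * Real.exp (-r * x) * f x := by
  rw [expMeasure_eq_withDensity, integral_withDensity_eq_integral_toReal_smul
    (measurable_exponentialPDF r)
    (Filter.Eventually.of_forall fun x => ENNReal.ofReal_lt_top), ← integral_Ici_eq_integral_Ioi,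
    ← integral_indicator measurableSet_Ici]
  congr 1
  ext x
  by_cases hx : 0 ≤ x
  · rw [Set.indicator_of_mem (Set.mem_Ici.2 hx), exponentialPDF_of_nonneg hx,
      ENNReal.toReal_ofReal (by positivity), smul_eq_mul, neg_mul]
  · rw [Set.indicator_of_notMem (by simpa using hx), exponentialPDF_of_neg (not_le.1 hx)]
    simp

theorem expMeasure_real_Iic {r : ℝ} (hr : 0 < r) {x : ℝ} (hx : 0 ≤ x) :
    (expMeasure r).real (Set.Iic x) = 1 - Real.exp (-(r * x)) := by
  have := isProbabilityMeasure_expMeasure hr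
  rw [← cdf_eq_real, cdf_expMeasure_eq hr, if_pos hx]

theorem expMeasure_real_Ioi {r : ℝ} (hr : 0 < r) {x : ℝ} (hx : 0 ≤ x) :
    (expMeasure r).real (Set.Ioi x) = Real.exp (-(r * x)) := by
  have := isProbabilityMeasure_expMeasure hr
  rw [← Set.compl_Iic, probReal_compl_eq_one_sub measurableSet_Iic, expMeasure_real_Iic hr hx]
  ring

theorem ae_nonneg_expMeasure (r : ℝ) : ∀ᵐ x ∂(expMeasure r), 0 ≤ x := by
  rw [expMeasure_eq_withDensity,
    ae_withDensity_iff (measurable_exponentialPDF r)]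
  refine Filter.Eventually.of_forall fun x hx => ?_
  by_contra h
  exact hx (exponentialPDF_of_neg (not_le.1 h))

/-! ### Poisson occupancy weights -/

/-- `f (m - 1)`, read as `0` for `m = 0`. -/
def prevTerm (f : ℕ → ℝ → ℝ) : ℕ → ℝ → ℝ
  | 0, _ => 0
  | m + 1, t => f m t

/-- The weight at `m` of the Poisson law with mean `ρ (1 - e^{-t})`. -/
noncomputable def occupancyWeight (ρ : ℝ) (m : ℕ) (t : ℝ) : ℝ :=
  Real.exp (-ρ * (1 - Real.exp (-t))) * (ρ * (1 - Real.exp (-t))) ^ m / m !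

theorem continuous_occupancyWeight (ρ : ℝ) (m : ℕ) : Continuous (occupancyWeight ρ m) := by
  unfold occupancyWeight; fun_prop

theorem continuous_prevTerm {f : ℕ → ℝ → ℝ} (hf : ∀ m, Continuous (f m)) (m : ℕ) :
    Continuous (prevTerm f m) := by
  rcases m with _ | m
  · exact continuous_const
  · exact hf m

/-- A Poisson weight differentiated in its mean is the difference of consecutive weights, and the
mean ρ(1-e^{-t}) has derivative ρ e^{-t}. -/
theorem hasDerivAt_occupancyWeight (ρ : ℝ) (m : ℕ) (t : ℝ) :
    HasDerivAt (occupancyWeight ρ m) (ρ * Real.exp (-t) *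
      (prevTerm (occupancyWeight ρ) m t - occupancyWeight ρ m t)) t := by
  have e1 : HasDerivAt (fun t : ℝ => 1 - Real.exp (-t)) (Real.exp (-t)) t := by
    simpa using ((hasDerivAt_neg t).exp.const_sub 1)
  have e2 := (((e1.const_mul (-ρ)).exp).mul ((e1.const_mul ρ).pow m)).div_const (m ! : ℝ)
  refine e2.congr_deriv ?_
  simp only [Pi.pow_apply]
  rcases m with _ | m
  · simp [prevTerm, occupancyWeight]; ring
  · simp only [prevTerm, occupancyWeight, Nat.factorial_succ, Nat.add_sub_cancel]
    push_cast
    field_simp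
    ring

theorem occupancyWeight_mem_Icc {ρ : ℝ} (hρ : 0 < ρ) (m : ℕ) {t : ℝ} (ht : 0 ≤ t) :
    occupancyWeight ρ m t ∈ Set.Icc (0 : ℝ) 1 := by
  have h0 := (one_sub_exp_neg_mem_Icc ht).1
  unfold occupancyWeight
  refine ⟨by positivity, ?_⟩
  have h := Real.pow_div_factorial_le_exp (ρ * (1 - Real.exp (-t))) (by positivity) m
  calc _ = Real.exp (-ρ * (1 - Real.exp (-t))) * ((ρ * (1 - Real.exp (-t))) ^ m / m !) := by ring
    _ ≤ Real.exp (-ρ * (1 - Real.exp (-t))) * Real.exp (ρ * (1 - Real.exp (-t))) := by gcongr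
    _ = 1 := by rw [← Real.exp_add]; simp

/-- First-arrival decomposition of the occupancy weights. -/
theorem integral_occupancyWeight_sub {ρ : ℝ} (hρ : 0 < ρ) (m : ℕ) {t : ℝ} (ht : 0 ≤ t) :
    ∫ s in Set.Ioi (0 : ℝ), ρ * Real.exp (-ρ * s) * (if s ≤ t then
        occupancyWeight ρ m (t - s) + (prevTerm (occupancyWeight ρ) m (t - s) -
          occupancyWeight ρ m (t - s)) * Real.exp (-(t - s))
      else occupancyWeight ρ m 0) = occupancyWeight ρ m t := by
  set G : ℝ → ℝ := fun s => ρ * Real.exp (-ρ * s) * (occupancyWeight ρ m (t - s) +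
    (prevTerm (occupancyWeight ρ) m (t - s) - occupancyWeight ρ m (t - s)) *
      Real.exp (-(t - s))) with hG
  have c1 := continuous_occupancyWeight ρ m
  have c2 := continuous_prevTerm (continuous_occupancyWeight ρ) m
  have hGc : Continuous G := by fun_prop
  -- On s ≤ t the integrand is an exact derivative; its boundary term -e^{-ρt} w_m(0), with w_m the
  -- weight, is cancelled by the part s > t.
  have hd : ∀ s, HasDerivAt (fun s => -(Real.exp (-ρ * s) * occupancyWeight ρ m (t - s))) (G s) s := by
    intro s
    have e1 : HasDerivAt (fun s => Real.exp (-ρ * s)) (Real.exp (-ρ * s) * (-ρ)) s := by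
      simpa using ((hasDerivAt_id s).const_mul (-ρ)).exp
    have e2 := (hasDerivAt_occupancyWeight ρ m (t - s)).comp s ((hasDerivAt_id s).const_sub t)
    refine (e1.mul e2).neg.congr_deriv ?_
    simp only [hG, Function.comp]
    ring
  have h1 : ∫ s in (0 : ℝ)..t, G s = occupancyWeight ρ m t
      - Real.exp (-ρ * t) * occupancyWeight ρ m 0 := by
    rw [intervalIntegral.integral_eq_sub_of_hasDerivAt (fun s _ => hd s)
      (hGc.intervalIntegrable 0 t)]
    simp; ring
  have hIoc : IntegrableOn (fun s => ρ * Real.exp (-ρ * s) * (if s ≤ t then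
        occupancyWeight ρ m (t - s) + (prevTerm (occupancyWeight ρ) m (t - s) -
          occupancyWeight ρ m (t - s)) * Real.exp (-(t - s))
      else occupancyWeight ρ m 0)) (Set.Ioc 0 t) := by
    refine IntegrableOn.congr_fun (f := G) (hGc.integrableOn_Ioc) (fun s hs => ?_) measurableSet_Ioc
    simp only [hG, if_pos hs.2]
  have hIoi : IntegrableOn (fun s => ρ * Real.exp (-ρ * s) * (if s ≤ t then
        occupancyWeight ρ m (t - s) + (prevTerm (occupancyWeight ρ) m (t - s) -
          occupancyWeight ρ m (t - s)) * Real.exp (-(t - s))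
      else occupancyWeight ρ m 0)) (Set.Ioi t) := by
    refine IntegrableOn.congr_fun
      (f := fun s => ρ * Real.exp (-ρ * s) * occupancyWeight ρ m 0)
      (((exp_neg_integrableOn_Ioi t hρ).const_mul ρ).mul_const _) (fun s hs => ?_) measurableSet_Ioi
    simp only [if_neg (not_le.2 (Set.mem_Ioi.1 hs))]
  rw [← Set.Ioc_union_Ioi_eq_Ioi ht, setIntegral_union Set.Ioc_disjoint_Ioi_same measurableSet_Ioi
    hIoc hIoi]
  have h2 := setIntegral_congr_fun (μ := volume) measurableSet_Ioc (s := Set.Ioc 0 t)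
    (f := fun s => ρ * Real.exp (-ρ * s) * (if s ≤ t then
        occupancyWeight ρ m (t - s) + (prevTerm (occupancyWeight ρ) m (t - s) -
          occupancyWeight ρ m (t - s)) * Real.exp (-(t - s))
      else occupancyWeight ρ m 0)) (g := G) (fun s hs => by simp only [hG, if_pos hs.2])
  have h3 := setIntegral_congr_fun (μ := volume) measurableSet_Ioi (s := Set.Ioi t)
    (f := fun s => ρ * Real.exp (-ρ * s) * (if s ≤ t then
        occupancyWeight ρ m (t - s) + (prevTerm (occupancyWeight ρ) m (t - s) -
          occupancyWeight ρ m (t - s)) * Real.exp (-(t - s))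
      else occupancyWeight ρ m 0)) (g := fun s => ρ * Real.exp (-ρ * s) * occupancyWeight ρ m 0)
      (fun s hs => by simp only [if_neg (not_le.2 (Set.mem_Ioi.1 hs))])
  rw [h2, h3, ← intervalIntegral.integral_of_le ht, h1, integral_mul_const, integral_const_mul,
    integral_exp_mul_Ioi (by linarith)]
  field_simp
  ring

/-! ### Splitting off the first customer; independence -/

theorem measurable_numCustomers {Ω : Type*} [MeasurableSpace Ω] {τ S : ℕ → Ω → ℝ}
    (hτ : ∀ i, Measurable (τ i)) (hS : ∀ i, Measurable (S i)) :
    Measurable fun p : ℝ × Ω => numCustomers τ S p.1 p.2 := by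
  have hA : ∀ i, Measurable (arrivalTime τ i) := fun i => by
    unfold arrivalTime; fun_prop
  unfold numCustomers
  refine measurable_encard.comp (measurable_set_iff.2 fun i => ?_)
  refine measurableSet_setOfPred.1 ?_
  exact (measurableSet_le ((hA i).comp measurable_snd) measurable_fst).inter
    (measurableSet_lt measurable_fst (((hA i).add (hS i)).comp measurable_snd))

/-- Splitting off the first customer. -/
theorem numCustomers_eq_add {Ω : Type*} (τ S : ℕ → Ω → ℝ) (t : ℝ) (ω : Ω) :
    numCustomers τ S t ω = numCustomers (fun i => τ (i + 1)) (fun i => S (i + 1)) (t - τ 0 ω) ω +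
      (if τ 0 ω ≤ t ∧ t < τ 0 ω + S 0 ω then 1 else 0) := by
  have hA : ∀ i, arrivalTime τ (i + 1) ω = τ 0 ω + arrivalTime (fun i => τ (i + 1)) i ω := by
    intro i
    unfold arrivalTime
    rw [Finset.sum_range_succ', add_comm]
  have hA0 : arrivalTime τ 0 ω = τ 0 ω := by simp [arrivalTime]
  unfold numCustomers
  set B := {i : ℕ | arrivalTime (fun i => τ (i + 1)) i ω ≤ t - τ 0 ω ∧
    t - τ 0 ω < arrivalTime (fun i => τ (i + 1)) i ω + S (i + 1) ω} with hB
  have hset : {i : ℕ | arrivalTime τ i ω ≤ t ∧ t < arrivalTime τ i ω + S i ω} =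
      Nat.succ '' B ∪ (if τ 0 ω ≤ t ∧ t < τ 0 ω + S 0 ω then {0} else ∅) := by
    ext i
    rcases i with _ | i
    · simp only [Set.mem_ofPred_eq, hA0, Set.mem_union, Set.mem_image]
      split_ifs with h <;> simp [h]
    · have h1 : (i + 1) ∉ (if τ 0 ω ≤ t ∧ t < τ 0 ω + S 0 ω then ({0} : Set ℕ) else ∅) := by
        split_ifs <;> simp
      have h2 : i + 1 ∈ Nat.succ '' B ↔ i ∈ B := Nat.succ_injective.mem_set_image
      rw [Set.mem_union, or_iff_left h1, h2]
      simp only [Set.mem_ofPred_eq, hB, hA]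
      constructor <;> rintro ⟨h3, h4⟩ <;> constructor <;> linarith
  rw [hset, Set.encard_union_eq, Nat.succ_injective.encard_image]
  · split_ifs <;> simp
  · rw [Set.disjoint_right]
    intro i hi
    split_ifs at hi
    · rw [Set.mem_singleton_iff.1 hi]; simp
    · exact absurd hi (by simp)

/-- Conditioning on one of two independent variables. -/
theorem IndepFun.measureReal_eq_integral {Ω α β : Type*} [MeasurableSpace Ω] [MeasurableSpace α]
    [MeasurableSpace β] {μ : Measure Ω} [IsProbabilityMeasure μ] {X : Ω → α} {Y : Ω → β}
    (hX : Measurable X) (hY : Measurable Y) (h : IndepFun X Y μ) {E : Set (α × β)}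
    (hE : MeasurableSet E) :
    μ.real {ω | (X ω, Y ω) ∈ E} = ∫ x, μ.real {ω | (x, Y ω) ∈ E} ∂(μ.map X) := by
  have h1 := (indepFun_iff_map_prod_eq_prod_map_map hX.aemeasurable hY.aemeasurable).1 h
  have h2 : μ {ω | (X ω, Y ω) ∈ E} = (μ.map fun ω => (X ω, Y ω)) E :=
    (Measure.map_apply (hX.prodMk hY) hE).symm
  have h3 : ∀ x, μ {ω | (x, Y ω) ∈ E} = μ.map Y (Prod.mk x ⁻¹' E) := fun x =>
    (Measure.map_apply hY (measurable_prodMk_left hE)).symm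
  have := Measure.isProbabilityMeasure_map (μ := μ) hY.aemeasurable
  simp only [Measure.real, h2, h3]
  rw [h1, Measure.prod_apply hE, integral_toReal]
  · exact (measurable_measure_prodMk_left hE).aemeasurable
  · exact Filter.Eventually.of_forall fun x => measure_lt_top _ _

theorem comap_coords_le_iSup {Ω ι κ : Type*} (X : ι → Ω → ℝ) (e : κ → ι) :
    MeasurableSpace.comap (fun ω i => X (e i) ω) MeasurableSpace.pi ≤
      ⨆ i ∈ Set.range e, MeasurableSpace.comap (X i) inferInstance := by
  rw [← measurable_iff_comap_le]
  refine @measurable_pi_lambda _ _ _ (_) _ _ fun i => ?_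
  rw [measurable_iff_comap_le]
  exact le_iSup₂_of_le (e i) ⟨i, rfl⟩ le_rfl

/-- Families of coordinates of an independent family with disjoint index ranges. -/
theorem iIndepFun.indepFun_comp_index {Ω ι κ κ' : Type*} [MeasurableSpace Ω] {μ : Measure Ω}
    {X : ι → Ω → ℝ} (hX : ∀ i, Measurable (X i)) (h : iIndepFun X μ) (e : κ → ι) (e' : κ' → ι)
    (hd : ∀ i j, e i ≠ e' j) :
    IndepFun (fun ω i => X (e i) ω) (fun ω j => X (e' j) ω) μ := by
  have hdisj : Disjoint (Set.range e) (Set.range e') := by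
    rw [Set.disjoint_left]
    rintro _ ⟨i, rfl⟩ ⟨j, hj⟩
    exact hd i j hj.symm
  have h1 := indep_iSup_of_disjoint (m := fun i => MeasurableSpace.comap (X i) inferInstance)
    (fun i => (hX i).comap_le) ((iIndepFun_iff_iIndep _ _ _).1 h) hdisj
  rw [IndepFun_iff_Indep]
  exact indep_of_indep_of_le_right (indep_of_indep_of_le_left h1
    (comap_coords_le_iSup X e)) (comap_coords_le_iSup X e')

/-! ### The renewal equation and its uniqueness -/

theorem measurable_prevTerm {f : ℕ → ℝ → ℝ} (hf : ∀ m, Measurable (f m)) (m : ℕ) :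
    Measurable (prevTerm f m) := by
  rcases m with _ | m
  · exact measurable_const
  · exact hf m

theorem prevTerm_mem_Icc {f : ℕ → ℝ → ℝ} (hf : ∀ m t, f m t ∈ Set.Icc (0 : ℝ) 1) (m : ℕ) (t : ℝ) :
    prevTerm f m t ∈ Set.Icc (0 : ℝ) 1 := by
  rcases m with _ | m
  · simp [prevTerm]
  · exact hf m t

theorem integrable_renewalIntegrand {ν : Measure (ℝ × ℝ)} [IsFiniteMeasure ν] {B : Set (ℝ × ℝ)}
    (hB : MeasurableSet B) {f : ℕ → ℝ → ℝ} (hf : ∀ m, Measurable (f m))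
    (hf1 : ∀ m t, f m t ∈ Set.Icc (0 : ℝ) 1) (m : ℕ) (s : ℝ) :
    Integrable (fun x : ℝ × ℝ => B.indicator
      (fun x => prevTerm f m (s - x.1) - f m (s - x.1)) x + f m (s - x.1)) ν := by
  have hg : Measurable fun x : ℝ × ℝ => s - x.1 := by fun_prop
  refine Integrable.of_bound (Measurable.aestronglyMeasurable
    (((((measurable_prevTerm hf m).comp hg).sub ((hf m).comp hg)).indicator hB).add
      ((hf m).comp hg))) 1 (Filter.Eventually.of_forall fun x => ?_)
  have h1 := prevTerm_mem_Icc hf1 m (s - x.1)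
  have h2 := hf1 m (s - x.1)
  by_cases hx : x ∈ B
  · simp only [Set.indicator_of_mem hx, sub_add_cancel]
    rw [Real.norm_of_nonneg h1.1]; exact h1.2
  · simp only [Set.indicator_of_notMem hx, zero_add]
    rw [Real.norm_of_nonneg h2.1]; exact h2.2

/-- Uniqueness of the bounded solution of the renewal equation of the queue, for a sequence of
unknowns `p n`, each expressed through the next. -/
theorem eq_of_renewal {ν : Measure (ℝ × ℝ)} [IsProbabilityMeasure ν] (A : ℝ → Set (ℝ × ℝ))
    (hA : ∀ t, MeasurableSet (A t)) {p : ℕ → ℕ → ℝ → ℝ} {q : ℕ → ℝ → ℝ}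
    (hp : ∀ n m, Measurable (p n m)) (hq : ∀ m, Measurable (q m))
    (hp1 : ∀ n m t, p n m t ∈ Set.Icc (0 : ℝ) 1) (hq1 : ∀ m t, q m t ∈ Set.Icc (0 : ℝ) 1)
    (hneg : ∀ n m t, t < 0 → p n m t = q m t)
    (hν : ∀ᵐ x ∂ν, 0 ≤ x.1) (hlt : ∀ t, 0 ≤ t → ν.real {x | x.1 ≤ t} < 1)
    (hpeq : ∀ n m t, 0 ≤ t → p n m t = ∫ x, (A t).indicator
      (fun x => prevTerm (p (n + 1)) m (t - x.1) - p (n + 1) m (t - x.1)) x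
        + p (n + 1) m (t - x.1) ∂ν)
    (hqeq : ∀ m t, 0 ≤ t → q m t = ∫ x, (A t).indicator
      (fun x => prevTerm q m (t - x.1) - q m (t - x.1)) x + q m (t - x.1) ∂ν)
    (n m : ℕ) (t : ℝ) : p n m t = q m t := by
  rcases lt_or_ge t 0 with ht | ht₀
  · exact hneg n m t ht
  set c := ν.real {x | x.1 ≤ t} with hc
  have hc0 : 0 ≤ c := measureReal_nonneg
  have hms : ∀ u, MeasurableSet {x : ℝ × ℝ | x.1 ≤ u} := fun u =>
    measurableSet_le measurable_fst measurable_const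
  -- Each use of the equation gains a factor c, the probability that the first arrival is by time t:
  -- a later arrival leads to negative times, where p and q agree. The bound must be uniform in n,
  -- as p n is expressed through p (n + 1).
  have main : ∀ j n m s, s ≤ t → |p n m s - q m s| ≤ c ^ j := by
    intro j
    induction j with
    | zero =>
      intro n m s _
      have h1 := hp1 n m s
      have h2 := hq1 m s
      rw [pow_zero, abs_le]
      constructor <;> linarith [h1.1, h1.2, h2.1, h2.2]
    | succ j ih =>
      intro n m s hs
      rcases lt_or_ge s 0 with hs0 | hs0
      · rw [hneg n m s hs0, sub_self, abs_zero]; positivity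
      rw [hpeq n m s hs0, hqeq m s hs0, ← integral_sub
        (integrable_renewalIntegrand (hA s) (hp (n + 1)) (hp1 (n + 1)) m s)
        (integrable_renewalIntegrand (hA s) hq hq1 m s), ← Real.norm_eq_abs]
      have hbd : ∀ᵐ x ∂ν, ‖((A s).indicator
          (fun x => prevTerm (p (n + 1)) m (s - x.1) - p (n + 1) m (s - x.1)) x
            + p (n + 1) m (s - x.1)) - ((A s).indicator
          (fun x => prevTerm q m (s - x.1) - q m (s - x.1)) x + q m (s - x.1))‖
          ≤ {x : ℝ × ℝ | x.1 ≤ t}.indicator (fun _ => c ^ j) x := by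
        filter_upwards [hν] with x hx0
        have hd : ∀ m, |p (n + 1) m (s - x.1) - q m (s - x.1)| ≤
            {x : ℝ × ℝ | x.1 ≤ t}.indicator (fun _ => c ^ j) x := by
          intro m
          by_cases hx : x.1 ≤ t
          · rw [Set.indicator_of_mem (by exact hx)]
            exact ih (n + 1) m _ (by linarith)
          · rw [hneg _ _ _ (by linarith [not_le.1 hx]), sub_self, abs_zero]
            exact Set.indicator_nonneg (fun _ _ => by positivity) _
        have hd' : |prevTerm (p (n + 1)) m (s - x.1) - prevTerm q m (s - x.1)| ≤
            {x : ℝ × ℝ | x.1 ≤ t}.indicator (fun _ => c ^ j) x := by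
          rcases m with _ | m
          · simp only [prevTerm, sub_self, abs_zero]
            exact Set.indicator_nonneg (fun _ _ => by positivity) _
          · exact hd m
        by_cases hx : x ∈ A s
        · simp only [Set.indicator_of_mem hx, sub_add_cancel]
          exact hd'
        · simp only [Set.indicator_of_notMem hx, zero_add]
          exact hd m
      refine (norm_integral_le_of_norm_le ((integrable_const _).indicator (hms t)) hbd).trans
        (le_of_eq ?_)
      rw [integral_indicator_const _ (hms t), smul_eq_mul, ← hc, pow_succ, mul_comm]
  have hlim := tendsto_pow_atTop_nhds_zero_of_lt_one hc0 (hlt t ht₀)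
  have h0 : |p n m t - q m t| ≤ 0 :=
    ge_of_tendsto' hlim fun j => main j n m t le_rfl
  exact sub_eq_zero.1 (abs_nonpos_iff.1 h0)

theorem occupancyWeight_zero (ρ : ℝ) (m : ℕ) :
    occupancyWeight ρ m 0 = if m = 0 then 1 else 0 := by
  rcases m with _ | m <;> simp [occupancyWeight]

/-- The Poisson weights of the queue at time `t`, extended by an empty queue to negative times. -/
noncomputable def queueWeight (ρ : ℝ) (m : ℕ) (t : ℝ) : ℝ :=
  occupancyWeight ρ m (max t 0)

theorem prevTerm_queueWeight (ρ : ℝ) (m : ℕ) (t : ℝ) :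
    prevTerm (queueWeight ρ) m t = prevTerm (occupancyWeight ρ) m (max t 0) := by
  rcases m with _ | m <;> rfl

/-- The (arrival, service) pairs of a first customer who is present at time `t`. -/
def presentAt (t : ℝ) : Set (ℝ × ℝ) := {x | x.1 ≤ t ∧ t < x.1 + x.2}

theorem mem_presentAt {t : ℝ} {x : ℝ × ℝ} : x ∈ presentAt t ↔ x.1 ≤ t ∧ t < x.1 + x.2 := Iff.rfl

theorem measurableSet_presentAt (t : ℝ) : MeasurableSet (presentAt t) :=
  (measurableSet_le measurable_fst measurable_const).inter
    (measurableSet_lt measurable_const (measurable_fst.add measurable_snd))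

theorem measurable_queueWeight (ρ : ℝ) (m : ℕ) : Measurable (queueWeight ρ m) :=
  (continuous_occupancyWeight ρ m).measurable.comp (measurable_id.max measurable_const)

theorem queueWeight_mem_Icc {ρ : ℝ} (hρ : 0 < ρ) (m : ℕ) (t : ℝ) :
    queueWeight ρ m t ∈ Set.Icc (0 : ℝ) 1 :=
  occupancyWeight_mem_Icc hρ m (le_max_right t 0)

/-- Integrate out the service time: a customer arriving at s ≤ t is still present at t with
probability e^{-(t-s)}. What remains is the first-arrival identity `integral_occupancyWeight_sub`.
-/
theorem queueWeight_renewal {ρ : ℝ} (hρ : 0 < ρ) (m : ℕ) {t : ℝ} (ht : 0 ≤ t) :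
    queueWeight ρ m t = ∫ x, (presentAt t).indicator
      (fun x => prevTerm (queueWeight ρ) m (t - x.1) - queueWeight ρ m (t - x.1)) x
        + queueWeight ρ m (t - x.1) ∂((expMeasure ρ).prod (expMeasure 1)) := by
  have := isProbabilityMeasure_expMeasure hρ
  have := isProbabilityMeasure_expMeasure one_pos
  rw [integral_prod _ (integrable_renewalIntegrand (measurableSet_presentAt t)
    (measurable_queueWeight ρ) (queueWeight_mem_Icc hρ) m t), integral_expMeasure hρ]
  rw [queueWeight, max_eq_left ht, ← integral_occupancyWeight_sub hρ m ht]
  refine setIntegral_congr_fun measurableSet_Ioi fun s _ => ?_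
  simp only
  congr 1
  by_cases hs : s ≤ t
  · have hu : 0 ≤ t - s := sub_nonneg.2 hs
    have e : ∀ y, (presentAt t).indicator (fun x : ℝ × ℝ => prevTerm (queueWeight ρ) m (t - x.1)
        - queueWeight ρ m (t - x.1)) (s, y) = (Set.Ioi (t - s)).indicator
        (fun _ => prevTerm (queueWeight ρ) m (t - s) - queueWeight ρ m (t - s)) y := by
      intro y
      by_cases hy : t - s < y
      · have h : (s, y) ∈ presentAt t := mem_presentAt.2 ⟨hs, by simp only; linarith⟩
        rw [Set.indicator_of_mem (Set.mem_Ioi.2 hy), Set.indicator_of_mem h]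
      · have h : (s, y) ∉ presentAt t := fun h => hy (by linarith [(mem_presentAt.1 h).2])
        rw [Set.indicator_of_notMem (fun h' => hy (Set.mem_Ioi.1 h')), Set.indicator_of_notMem h]
    simp only [e, if_pos hs]
    rw [integral_add ((integrable_const _).indicator measurableSet_Ioi) (integrable_const _),
      integral_indicator_const _ measurableSet_Ioi, expMeasure_real_Ioi one_pos hu]
    simp only [integral_const, probReal_univ, smul_eq_mul, one_mul,
      prevTerm_queueWeight, queueWeight, max_eq_left hu]
    ring
  · have e : ∀ y, (presentAt t).indicator (fun x : ℝ × ℝ => prevTerm (queueWeight ρ) m (t - x.1)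
        - queueWeight ρ m (t - x.1)) (s, y) = 0 := fun y =>
      Set.indicator_of_notMem (fun h => hs (mem_presentAt.1 h).1) _
    have hu : max (t - s) 0 = 0 := max_eq_right (by linarith [not_le.1 hs])
    simp only [e, if_neg hs, zero_add, integral_const, probReal_univ, one_smul]
    rw [queueWeight, hu]

/-! ### Law of the number of customers -/

section
variable {Ω : Type*} {τ S : ℕ → Ω → ℝ}

/-- The number of customers at time `t`, read off the sequence of interarrival and service
times. -/
noncomputable def seqCount (t : ℝ) (y : ℕ ⊕ ℕ → ℝ) : ℕ∞ :=
  numCustomers (fun i (y : ℕ ⊕ ℕ → ℝ) => y (Sum.inl i)) (fun i y => y (Sum.inr i)) t y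

theorem measurable_seqCount : Measurable fun p : ℝ × (ℕ ⊕ ℕ → ℝ) => seqCount p.1 p.2 :=
  measurable_numCustomers (fun i => by fun_prop) (fun i => by fun_prop)

/-- The interarrival and service times from customer `n` on. -/
def tailSeq (τ S : ℕ → Ω → ℝ) (n : ℕ) (ω : Ω) : ℕ ⊕ ℕ → ℝ :=
  Sum.elim (fun i => τ (n + i) ω) (fun i => S (n + i) ω)

theorem measurable_tailSeq [MeasurableSpace Ω] (hτ : ∀ i, Measurable (τ i)) (hS : ∀ i, Measurable (S i)) (n : ℕ) :
    Measurable (tailSeq τ S n) := by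
  refine measurable_pi_lambda _ fun i => ?_
  rcases i with i | i
  · exact hτ _
  · exact hS _

theorem seqCount_tailSeq (n : ℕ) (t : ℝ) (ω : Ω) :
    seqCount t (tailSeq τ S n ω)
      = numCustomers (fun i => τ (n + i)) (fun i => S (n + i)) t ω := rfl

attribute [irreducible] seqCount

theorem seqCount_tailSeq_succ (n : ℕ) (t : ℝ) (ω : Ω) :
    seqCount t (tailSeq τ S n ω) = seqCount (t - τ n ω) (tailSeq τ S (n + 1) ω) +
      (if τ n ω ≤ t ∧ t < τ n ω + S n ω then 1 else 0) := by
  rw [seqCount_tailSeq, numCustomers_eq_add, seqCount_tailSeq]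
  have h : ∀ f : ℕ → Ω → ℝ, (fun i => f (n + (i + 1))) = fun i => f (n + 1 + i) := fun f => by
    funext i
    rw [add_assoc, add_comm 1 i]
  rw [h τ, h S]
  rfl

variable [MeasurableSpace Ω] {μ : Measure Ω} {ρ σ : ℝ} {T : Ω → ℝ}

theorem indepFun_pair_tailSeq (hQ : IsObservedMMInfQueue μ ρ σ τ S T)
    (hτ : ∀ i, Measurable (τ i)) (hS : ∀ i, Measurable (S i)) (hT : Measurable T) (n : ℕ) :
    IndepFun (fun ω => (τ n ω, S n ω)) (tailSeq τ S (n + 1)) μ := by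
  have hX : ∀ i, Measurable (Sum.elim τ (Sum.elim S (fun _ : Unit => T)) i) := by
    rintro (i | i | i)
    exacts [hτ i, hS i, hT]
  have h := iIndepFun.indepFun_comp_index hX hQ.indep
    (fun b : Bool => bif b then Sum.inl n else Sum.inr (Sum.inl n))
    (Sum.elim (fun i => Sum.inl (n + 1 + i)) (fun i => Sum.inr (Sum.inl (n + 1 + i))))
    (by
      rintro (_ | _) (j | j) <;> simp <;> omega)
  have hm : Measurable fun f : Bool → ℝ => (f true, f false) := by fun_prop
  have h2 := h.comp hm measurable_id
  have e : tailSeq τ S (n + 1) = fun ω j => Sum.elim τ (Sum.elim S (fun _ : Unit => T))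
      (Sum.elim (fun i => Sum.inl (n + 1 + i)) (fun i => Sum.inr (Sum.inl (n + 1 + i))) j) ω := by
    funext ω j
    rcases j with j | j <;> rfl
  rw [e]
  exact h2

theorem indepFun_observer_tailSeq (hQ : IsObservedMMInfQueue μ ρ σ τ S T)
    (hτ : ∀ i, Measurable (τ i)) (hS : ∀ i, Measurable (S i)) (hT : Measurable T) :
    IndepFun T (tailSeq τ S 0) μ := by
  have hX : ∀ i, Measurable (Sum.elim τ (Sum.elim S (fun _ : Unit => T)) i) := by
    rintro (i | i | i)
    exacts [hτ i, hS i, hT]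
  have h := iIndepFun.indepFun_comp_index hX hQ.indep
    (fun _ : Unit => Sum.inr (Sum.inr ()))
    (Sum.elim (fun i => Sum.inl (0 + i)) (fun i => Sum.inr (Sum.inl (0 + i))))
    (by rintro _ (j | j) <;> simp)
  have hm : Measurable fun f : Unit → ℝ => f () := by fun_prop
  have h2 := h.comp hm measurable_id
  have e : tailSeq τ S (0) = fun ω j => Sum.elim τ (Sum.elim S (fun _ : Unit => T))
      (Sum.elim (fun i => Sum.inl (0 + i)) (fun i => Sum.inr (Sum.inl (0 + i))) j) ω := by
    funext ω j
    rcases j with j | j <;> rfl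
  rw [e]
  exact h2

theorem map_pair [IsProbabilityMeasure μ] (hQ : IsObservedMMInfQueue μ ρ σ τ S T)
    (hτ : ∀ i, Measurable (τ i)) (hS : ∀ i, Measurable (S i)) (n : ℕ) :
    μ.map (fun ω => (τ n ω, S n ω)) = (expMeasure ρ).prod (expMeasure 1) := by
  have h : IndepFun (τ n) (S n) μ :=
    hQ.indep.indepFun (i := Sum.inl n) (j := Sum.inr (Sum.inl n)) (by simp)
  rw [(indepFun_iff_map_prod_eq_prod_map_map (hτ n).aemeasurable (hS n).aemeasurable).1 h,
    (hQ.interarrival_law n).map_eq, (hQ.service_law n).map_eq]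

theorem seqCount_eq_zero_of_neg (hQ : IsObservedMMInfQueue μ ρ σ τ S T) (n : ℕ) {t : ℝ}
    (ht : t < 0) : ∀ᵐ ω ∂μ, seqCount t (tailSeq τ S n ω) = 0 := by
  have h : ∀ᵐ ω ∂μ, ∀ i, 0 ≤ τ i ω := ae_all_iff.2 fun i =>
    ((hQ.interarrival_law i).ae_iff (p := fun x => 0 ≤ x)
      (measurableSet_setOfPred.1 measurableSet_Ici)).2 (ae_nonneg_expMeasure ρ)
  filter_upwards [h] with ω hω
  rw [seqCount_tailSeq, numCustomers, Set.encard_eq_zero, Set.eq_empty_iff_forall_notMem]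
  rintro i ⟨h1, -⟩
  have : 0 ≤ arrivalTime (fun i => τ (n + i)) i ω := Finset.sum_nonneg fun j _ => hω _
  linarith

/-- Condition on the arrival and service times of customer n, independent of the later ones: if that
customer is present, the others must number m - 1 (impossible for m = 0), otherwise m. -/
theorem measureReal_seqCount_renewal [IsProbabilityMeasure μ] (hQ : IsObservedMMInfQueue μ ρ σ τ S T)
    (hτ : ∀ i, Measurable (τ i)) (hS : ∀ i, Measurable (S i)) (hT : Measurable T)
    {p : ℕ → ℕ → ℝ → ℝ}
    (hp : p = fun n (m : ℕ) t => μ.real {ω | seqCount t (tailSeq τ S n ω) = m})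
    (n m : ℕ) (t : ℝ) :
    p n m t = ∫ x, (presentAt t).indicator
      (fun x => prevTerm (p (n + 1)) m (t - x.1) - p (n + 1) m (t - x.1)) x
        + p (n + 1) m (t - x.1) ∂((expMeasure ρ).prod (expMeasure 1)) := by
  set E : Set ((ℝ × ℝ) × (ℕ ⊕ ℕ → ℝ)) :=
    {z | seqCount (t - z.1.1) z.2 + (if z.1.1 ≤ t ∧ t < z.1.1 + z.1.2 then 1 else 0) = (m : ℕ∞)} with hE
  have hEm : MeasurableSet E := by
    have h1 : Measurable fun z : (ℝ × ℝ) × (ℕ ⊕ ℕ → ℝ) => seqCount (t - z.1.1) z.2 := by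
      have hg : Measurable fun z : (ℝ × ℝ) × (ℕ ⊕ ℕ → ℝ) => (t - z.1.1, z.2) := by fun_prop
      exact measurable_seqCount.comp hg
    have h2 : Measurable fun z : (ℝ × ℝ) × (ℕ ⊕ ℕ → ℝ) =>
        (if z.1.1 ≤ t ∧ t < z.1.1 + z.1.2 then 1 else 0 : ℕ∞) :=
      Measurable.ite (measurable_fst (measurableSet_presentAt t)) measurable_const measurable_const
    have h3 : Measurable fun z : (ℝ × ℝ) × (ℕ ⊕ ℕ → ℝ) =>
        seqCount (t - z.1.1) z.2 + (if z.1.1 ≤ t ∧ t < z.1.1 + z.1.2 then 1 else 0 : ℕ∞) :=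
      (Measurable.of_discrete (f := fun a : ℕ∞ × ℕ∞ => a.1 + a.2)).comp (h1.prodMk h2)
    exact measurableSet_eq_fun h3 measurable_const
  have hpair : Measurable fun ω => (τ n ω, S n ω) := (hτ n).prodMk (hS n)
  have key := IndepFun.measureReal_eq_integral hpair (measurable_tailSeq hτ hS (n + 1))
    (indepFun_pair_tailSeq hQ hτ hS hT n) hEm
  rw [map_pair hQ hτ hS n] at key
  have hl : p n m t = μ.real {ω | ((τ n ω, S n ω), tailSeq τ S (n + 1) ω) ∈ E} := by
    rw [hp]
    simp only [seqCount_tailSeq_succ n t]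
    rfl
  rw [hl, key]
  congr 1
  ext x
  by_cases hx : x ∈ presentAt t
  · rw [Set.indicator_of_mem hx, sub_add_cancel]
    simp only [hE, Set.mem_ofPred_eq, if_pos (mem_presentAt.1 hx)]
    rcases m with _ | m
    · simp [prevTerm]
    · simp only [prevTerm, hp]
      congr 1
      ext ω
      simp only [Set.mem_ofPred_eq]
      push_cast
      exact ENat.add_left_injective_of_ne_top (ENat.one_ne_top) |>.eq_iff
  · rw [Set.indicator_of_notMem hx, zero_add]
    simp only [hE, Set.mem_ofPred_eq, if_neg (mt mem_presentAt.2 hx), add_zero, hp]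

/-- The number of customers at time `t` is Poisson with mean `ρ (1 - e^{-t})`. -/
theorem measureReal_seqCount_eq [IsProbabilityMeasure μ] (hρ : 0 < ρ) (hQ : IsObservedMMInfQueue μ ρ σ τ S T)
    (hτ : ∀ i, Measurable (τ i)) (hS : ∀ i, Measurable (S i)) (hT : Measurable T)
    (n m : ℕ) (t : ℝ) :
    μ.real {ω | seqCount t (tailSeq τ S n ω) = m} = queueWeight ρ m t := by
  have := isProbabilityMeasure_expMeasure hρ
  have := isProbabilityMeasure_expMeasure one_pos
  have hfst : Measure.map Prod.fst ((expMeasure ρ).prod (expMeasure 1)) = expMeasure ρ :=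
    measurePreserving_fst.map_eq
  -- The tails from each customer n are separate unknowns, so their equality in law need not be
  -- proved beforehand.
  refine eq_of_renewal (ν := (expMeasure ρ).prod (expMeasure 1)) presentAt
    measurableSet_presentAt
    (p := fun n (m : ℕ) t => μ.real {ω | seqCount t (tailSeq τ S n ω) = m})
    (q := queueWeight ρ) ?_ (measurable_queueWeight ρ) ?_ (queueWeight_mem_Icc hρ) ?_ ?_ ?_
    (fun n m t _ => measureReal_seqCount_renewal hQ hτ hS hT rfl n m t)
    (fun m t ht => queueWeight_renewal hρ m ht) n m t
  · intro n m
    have h1 : Measurable fun z : ℝ × Ω => seqCount z.1 (tailSeq τ S n z.2) := by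
      have hg : Measurable fun z : ℝ × Ω => (z.1, tailSeq τ S n z.2) :=
        measurable_fst.prodMk ((measurable_tailSeq hτ hS n).comp measurable_snd)
      exact measurable_seqCount.comp hg
    have hE : MeasurableSet {z : ℝ × Ω | seqCount z.1 (tailSeq τ S n z.2) = (m : ℕ∞)} :=
      measurableSet_eq_fun h1 measurable_const
    exact (measurable_measure_prodMk_left hE).ennreal_toReal
  · exact fun n m t => ⟨measureReal_nonneg, measureReal_le_one⟩
  · intro n m t ht
    have h := seqCount_eq_zero_of_neg hQ n ht
    rw [queueWeight, max_eq_right ht.le, occupancyWeight_zero]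
    split_ifs with hm
    · subst hm
      rw [← probReal_univ (μ := μ)]
      refine measureReal_congr (Filter.eventuallyEq_set.2 ?_)
      filter_upwards [h] with ω hω
      simp [hω]
    · rw [← measureReal_empty (μ := μ)]
      refine measureReal_congr (Filter.eventuallyEq_set.2 ?_)
      filter_upwards [h] with ω hω
      simpa [hω] using fun h0 => hm (by exact_mod_cast h0.symm)
  · have h0 := ae_nonneg_expMeasure ρ
    rw [← hfst] at h0
    exact (ae_map_iff measurable_fst.aemeasurable measurableSet_Ici).1 h0
  · intro t ht
    have h1 : ((expMeasure ρ).prod (expMeasure 1)).real {x | x.1 ≤ t}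
        = (expMeasure ρ).real (Set.Iic t) := by
      rw [← hfst, map_measureReal_apply measurable_fst measurableSet_Iic, hfst]
      rfl
    rw [h1, expMeasure_real_Iic hρ ht]
    linarith [Real.exp_pos (-(ρ * t))]

/-- Condition on the exit time and integrate the Poisson weight against σ e^{-σt}. -/
theorem measureReal_numAtObserverExit_of_measurable [IsProbabilityMeasure μ] (hρ : 0 < ρ) (hσ : 0 < σ)
    (hQ : IsObservedMMInfQueue μ ρ σ τ S T)
    (hτ : ∀ i, Measurable (τ i)) (hS : ∀ i, Measurable (S i)) (hT : Measurable T) (m : ℕ) :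
    μ.real {ω | numAtObserverExit τ S T ω = (m : ℕ∞)}
      = σ * (ρ ^ m / m !) * exitIntegral m σ ρ := by
  have hE : MeasurableSet {z : ℝ × (ℕ ⊕ ℕ → ℝ) | seqCount z.1 z.2 = m} :=
    measurable_seqCount (MeasurableSet.singleton (m : ℕ∞))
  have key := IndepFun.measureReal_eq_integral hT (measurable_tailSeq hτ hS 0)
    (indepFun_observer_tailSeq hQ hτ hS hT) hE
  have hl : {ω | numAtObserverExit τ S T ω = (m : ℕ∞)} =
      {ω | (T ω, tailSeq τ S 0 ω) ∈ {z : ℝ × (ℕ ⊕ ℕ → ℝ) | seqCount z.1 z.2 = m}} := by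
    ext ω
    simp only [Set.mem_ofPred_eq, seqCount_tailSeq, zero_add]
    rfl
  rw [hl, key, hQ.observer_law.map_eq]
  simp only [Set.mem_ofPred_eq, measureReal_seqCount_eq hρ hQ hτ hS hT 0 m]
  rw [integral_expMeasure hσ, exitIntegral, ← integral_const_mul]
  refine setIntegral_congr_fun measurableSet_Ioi fun t ht => ?_
  simp only [queueWeight, max_eq_left (le_of_lt (Set.mem_Ioi.1 ht)), occupancyWeight, mul_pow]
  ring

end

/-! ### Transfer to the product space and conclusion -/

/-- The law of the number of customers seen by the leaving observer. -/
theorem measureReal_numAtObserverExit {Ω : Type*} [MeasurableSpace Ω] {μ : Measure Ω}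
    {ρ σ : ℝ} {τ S : ℕ → Ω → ℝ} {T : Ω → ℝ} (hρ : 0 < ρ) (hσ : 0 < σ)
    (hQ : IsObservedMMInfQueue μ ρ σ τ S T) (m : ℕ) :
    μ.real {ω | numAtObserverExit τ S T ω = (m : ℕ∞)}
      = σ * (ρ ^ m / m !) * exitIntegral m σ ρ := by
  have i1 := isProbabilityMeasure_expMeasure hρ
  have i2 := isProbabilityMeasure_expMeasure one_pos
  have i3 := isProbabilityMeasure_expMeasure hσ
  -- The hypotheses give only a.e. measurable variables. The event depends on their joint law alone,
  -- so it is moved to the product space, whose coordinates are measurable.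
  set P : ℕ ⊕ ℕ ⊕ Unit → Measure ℝ :=
    Sum.elim (fun _ => expMeasure ρ) (Sum.elim (fun _ => expMeasure 1) (fun _ => expMeasure σ))
  have hP : ∀ i, IsProbabilityMeasure (P i) := by
    rintro (i | i | i)
    exacts [i1, i2, i3]
  have hlaw : ∀ i, HasLaw (Sum.elim τ (Sum.elim S (fun _ : Unit => T)) i) (P i) μ := by
    rintro (i | i | i)
    exacts [hQ.interarrival_law i, hQ.service_law i, hQ.observer_law]
  have hcan := hQ.indep.hasLaw_infinitePi hlaw
    (aemeasurable_pi_iff.2 fun i => (hlaw i).aemeasurable)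
  have hev : ∀ i, HasLaw (fun y : ℕ ⊕ ℕ ⊕ Unit → ℝ => y i) (P i) (Measure.infinitePi P) :=
    fun i => ⟨(measurable_pi_apply i).aemeasurable, Measure.infinitePi_map_eval P i⟩
  have hQ' : IsObservedMMInfQueue (Measure.infinitePi P) ρ σ
      (fun i y => y (Sum.inl i)) (fun i y => y (Sum.inr (Sum.inl i)))
      (fun y => y (Sum.inr (Sum.inr ()))) := by
    refine ⟨fun i => hev _, fun i => hev (Sum.inr (Sum.inl i)), hev (Sum.inr (Sum.inr ())), ?_⟩
    have h := iIndepFun_infinitePi (P := P) (X := fun _ x => x) (fun i => measurable_id)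
    convert h using 1
    ext i y
    rcases i with i | i | i <;> rfl
  have hmeas : MeasurableSet {y : ℕ ⊕ ℕ ⊕ Unit → ℝ | numAtObserverExit (fun i y => y (Sum.inl i))
      (fun i y => y (Sum.inr (Sum.inl i))) (fun y => y (Sum.inr (Sum.inr ()))) y = (m : ℕ∞)} := by
    have h := measurable_numCustomers (τ := fun i (y : ℕ ⊕ ℕ ⊕ Unit → ℝ) => y (Sum.inl i))
      (S := fun i y => y (Sum.inr (Sum.inl i))) (fun i => by fun_prop) (fun i => by fun_prop)
    have h2 : Measurable fun y : ℕ ⊕ ℕ ⊕ Unit → ℝ => (y (Sum.inr (Sum.inr ())), y) := by fun_prop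
    exact (h.comp h2) (MeasurableSet.singleton (m : ℕ∞))
  rw [← measureReal_numAtObserverExit_of_measurable hρ hσ hQ' (fun i => by fun_prop)
    (fun i => by fun_prop) (by fun_prop) m]
  exact hcan.measureReal_eq hmeas

theorem mainTheorem6 {Ω : Type*} [MeasurableSpace Ω] (μ : Measure Ω) [IsProbabilityMeasure μ]
    (ρ σ : ℝ) (hρ : 0 < ρ) (hσ : 0 < σ) (τ S : ℕ → Ω → ℝ) (T : Ω → ℝ)
    (hQ : IsObservedMMInfQueue μ ρ σ τ S T) (m : ℕ) :
    (Integrable (fun x => queuePoly ρ σ m x / (1 - x)) (spectralMeasure ρ σ) ∧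
      μ.real {ω | numAtObserverExit τ S T ω = (m : ℕ∞)} =
        σ / (σ + ρ) * (ρ ^ m / (m ! : ℝ)) *
          ∫ x, queuePoly ρ σ m x / (1 - x) ∂(spectralMeasure ρ σ)) ∧
    (IntegrableOn (fun x => charlier ρ m x / (σ + x)) (Set.Ici 0) (poissonOnReal ρ) ∧
      μ.real {ω | numAtObserverExit τ S T ω = (m : ℕ∞)} =
        σ * (ρ ^ m / (m ! : ℝ)) *
          ∫ x in Set.Ici 0, charlier ρ m x / (σ + x) ∂(poissonOnReal ρ)) := by
  obtain ⟨h1, h2⟩ := integrable_charlier_div hρ m hσ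
  refine ⟨⟨?_, ?_⟩, h1, ?_⟩
  · simpa using integrable_queuePoly_div hρ hσ m (s := 1) (by simp)
  · rw [integral_queuePoly_div hρ hσ, measureReal_numAtObserverExit hρ hσ hQ]
    have : σ + ρ ≠ 0 := by positivity
    field_simp
  · rw [h2, measureReal_numAtObserverExit hρ hσ hQ]
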